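/- **Setting.** Types $\theta\in\Theta=[0,1]$ have a distribution $F$ with a strictly positive, continuously differentiable density $f$; the cost $c:[0,1]\to(0,\infty)$ is continuously differentiable and strictly increasing, and there is $\theta^*\in(0,1)$ with $c(\theta^*)=\theta^*$, $c(\theta)>\theta$ for $\theta<\theta^*$ and $c(\theta)<\theta$ for $\theta>\theta^*$. Let $\hat c(\theta)=\min\{\theta,c(\theta)\}$ and $X=[0,1]$. A probability measure $\pi$ on $\Theta\times X$ is *feasible* if its first marginal is $F$, $\int_{\Theta\times B}(x-\theta)\,d\pi(\theta,x)=0$ for all measurable $B\subseteq X$, and $\pi(\{(\theta,x): x\in B,\ \hat c(\theta)>x\})=0$ for all measurable $B\subseteq X$. Assume that no feasible $\pi$ satisfies $\pi(\{x\ge\theta^*\})=1$. Let $\alpha:[0,1]\to(0,\infty)$ be measurable, bounded, and continuous on $[0,\theta^*]$. The *primal problem* is to maximize $\int \alpha(\theta)\mathbf 1_{\{x\ge\theta^*\}}\,d\pi(\theta,x)$ over feasible $\pi$. **Matching functions.** Let $g_1:[0,\bar\theta]\to[\theta^*,c(1)]$ and $g_2:[\underline\theta,\theta^*]\to[\theta^*,c(1)]$,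 with $\bar\theta\le\theta^*$ and $\underline\theta\ge 0$, be strictly decreasing bijections, differentiable on $[0,\bar\theta)$ and on $[\underline\theta,\theta^*)$ respectively, that satisfy for $g=g_1,g_2$ and $x\in(\theta^*,c(1)]$ $$x=\frac{g^{-1}(x)\,v(x)+c^{-1}(x)\,w(x)}{v(x)+w(x)},\qquad v=-f(g^{-1})\,(g^{-1})',\quad w=f(c^{-1})\,(c^{-1})',$$ where, at points $x=c(t)$ with $c'(t)=0$, the equation is understood after the change of variable $x=c(t)$: with $A(t)=g^{-1}(c(t))$, assumed differentiable on $(\theta^*,1]$, it reads $c(t)=\dfrac{-A(t)f(A(t))A'(t)+t f(t)}{-f(A(t))A'(t)+f(t)}$ for $t\in(\theta^*,1]$. Such functions exist, and $0<\bar\theta<\theta^*$, $0<\underline\theta<\theta^*$. For $x\in(\theta^*,c(1))$ put $\theta_1=g_1^{-1}(x)$ and $\theta_2=g_2^{-1}(x)$; then $0<\theta_1<\theta_2<\theta^*$. The pool–reveal–pool distribution $\pi^{x\text{-NAM}}$ has first marginal $F$ and assigns to type $\theta$ the posterior mean $g_1(\theta)$ if $\theta\in[0,\theta_1]$, $\theta$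 if $\theta\in(\theta_1,\theta_2)$, $g_2(\theta)$ if $\theta\in[\theta_2,\theta^*]$, and $c(\theta)$ if $\theta\in(\theta^*,1]$. **Proposition.** Suppose that for every $x\in[\theta^*,c(1)]$ the mapping $\theta\mapsto\frac{\alpha(\theta)}{x-\theta}$ is strictly convex on $[0,\theta^*]$ (on $[0,\theta^*)$ when $x=\theta^*$), and that $$\frac{\alpha(0)}{c(1)}>\frac{\alpha(\underline\theta)}{c(1)-\underline\theta}.$$ Then there exists $x\in(\theta^*,c(1))$ such that $\pi^{x\text{-NAM}}$ solves the primal problem. Conversely, if $\pi$ solves the primal problem, then there exists $x\in(\theta^*,c(1))$ such that the conditional distributions satisfy $\pi_\theta=\pi^{x\text{-NAM}}_\theta$ for $F$-almost every $\theta$. -/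

import Mathlib

open MeasureTheory ProbabilityTheory Set

noncomputable section

/-- A competitive lemons market with type space `[0,1]`: prior density `f`, production cost `c`,
and gains from trade at the top, i.e. `c` crosses the diagonal once, from above, at `θs` (written
`θ*` in comments). The functions are used only through their values on `[0,1]`. -/
structure Market where
  f : ℝ → ℝ
  c : ℝ → ℝ
  θs : ℝ
  f_contDiff : ContDiffOn ℝ 1 f (Icc 0 1)
  f_pos : ∀ θ ∈ Icc (0 : ℝ) 1, 0 < f θ
  f_integral : ∫ θ in Icc (0 : ℝ) 1, f θ = 1
  c_contDiff : ContDiffOn ℝ 1 c (Icc 0 1)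
  c_pos : ∀ θ ∈ Icc (0 : ℝ) 1, 0 < c θ
  c_strictMono : StrictMonoOn c (Icc 0 1)
  θs_mem : θs ∈ Ioo (0 : ℝ) 1
  c_θs : c θs = θs
  c_below : ∀ θ ∈ Ico 0 θs, θ < c θ
  c_above : ∀ θ ∈ Ioc θs 1, c θ < θ

namespace Market

variable (M : Market)

/-- The prior distribution `F` of the types, `dF(θ) = f(θ) dθ` on `[0,1]`. -/
def prior : Measure ℝ :=
  (volume.restrict (Icc (0 : ℝ) 1)).withDensity fun θ => ENNReal.ofReal (M.f θ)

instance : IsProbabilityMeasure M.prior := by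
  constructor
  have hint : Integrable M.f (volume.restrict (Icc (0 : ℝ) 1)) :=
    M.f_contDiff.continuousOn.integrableOn_compact isCompact_Icc
  have hnn : 0 ≤ᵐ[volume.restrict (Icc (0 : ℝ) 1)] M.f :=
    (ae_restrict_iff' measurableSet_Icc).2 (Filter.Eventually.of_forall fun θ hθ =>
      (M.f_pos θ hθ).le)
  rw [prior, withDensity_apply _ MeasurableSet.univ, Measure.restrict_univ,
    ← ofReal_integral_eq_lintegral_ofReal hint hnn, M.f_integral, ENNReal.ofReal_one]

/-- The auxiliary cost `ĉ(θ) = min {θ, c(θ)}`. -/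
def auxCost (θ : ℝ) : ℝ := min θ (M.c θ)

/-- Feasibility of a joint distribution `π` of types `θ = z.1` and posterior means `x = z.2`,
both ranging over `[0,1]`: Bayes plausibility, the martingale condition, and
the prices-as-means condition. -/
structure Feasible (π : Measure (ℝ × ℝ)) : Prop where
  prob : IsProbabilityMeasure π
  support : ∀ᵐ z ∂π, z ∈ Icc (0 : ℝ) 1 ×ˢ Icc (0 : ℝ) 1
  bayes : ∀ A : Set ℝ, MeasurableSet A → π (A ×ˢ univ) = M.prior A
  martingale : ∀ B : Set ℝ, MeasurableSet B → ∫ z in univ ×ˢ B, (z.2 - z.1) ∂π = 0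
  priceMean : ∀ B : Set ℝ, MeasurableSet B → π {z | z.2 ∈ B ∧ z.2 < M.auxCost z.1} = 0

/-- No feasible joint distribution makes all types trade, i.e. has `x ≥ θ*` with probability 1. -/
def NoFullTrade : Prop :=
  ¬ ∃ π : Measure (ℝ × ℝ), M.Feasible π ∧ π {z | M.θs ≤ z.2} = 1

/-- The weighted volume of trade `∫∫ α(θ) 1{x ≥ θ*} dπ(θ,x)`. -/
def volumeOfTrade (α : ℝ → ℝ) (π : Measure (ℝ × ℝ)) : ℝ :=
  ∫ z, {z : ℝ × ℝ | M.θs ≤ z.2}.indicator (fun z => α z.1) z ∂π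

/-- `π` solves the primal problem: it maximizes the weighted volume of trade over all feasible
joint distributions. -/
def IsSolution (α : ℝ → ℝ) (π : Measure (ℝ × ℝ)) : Prop :=
  M.Feasible π ∧
    ∀ π' : Measure (ℝ × ℝ), M.Feasible π' → M.volumeOfTrade α π' ≤ M.volumeOfTrade α π

/-- The inverse of `g : [lo,hi] → [θ*,c(1)]`. -/
def inv (g : ℝ → ℝ) (lo hi : ℝ) : ℝ → ℝ := Function.invFunOn g (Icc lo hi)

/-- `g` is a strictly decreasing, differentiable bijection from the interval `[lo,hi]` of
inefficient types onto `[θ*,c(1)]` which pools the type `g⁻¹(x)` with the type `t = c⁻¹(x)` so that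
the posterior mean equals `x`:
`x = (g⁻¹(x) v + c⁻¹(x) w) / (v + w)`, `v = - f(g⁻¹(x)) (g⁻¹)'(x)`, `w = f(c⁻¹(x)) (c⁻¹)'(x)`.
The equation is written at `x = c(t)` in the variable `t`: with `A(t) = g⁻¹(c(t))` one has
`A'(t) = (g⁻¹)'(x) c'(t)` and `(c⁻¹)'(x) c'(t) = 1`, and the common factor `c'(t)` of the two
weights cancels. So nothing changes where `c' > 0`, and the equation makes sense where `c' = 0`.
At `t = θ*`, where for `hi = θ*` both types coincide with the mean, nothing is imposed beyond the
continuity of `g`, which follows from monotonicity and bijectivity. -/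
structure IsMatching (g : ℝ → ℝ) (lo hi : ℝ) : Prop where
  lo_nonneg : 0 ≤ lo
  hi_le : hi ≤ M.θs
  strictAnti : StrictAntiOn g (Icc lo hi)
  bijOn : BijOn g (Icc lo hi) (Icc M.θs (M.c 1))
  differentiable : DifferentiableOn ℝ g (Ico lo hi)
  ode : ∀ t ∈ Ioc M.θs 1, ∃ A' : ℝ,
    HasDerivWithinAt (fun s => inv g lo hi (M.c s)) A' (Icc M.θs 1) t ∧
    M.c t =
      inv g lo hi (M.c t) *
          ((-M.f (inv g lo hi (M.c t)) * A') / (-M.f (inv g lo hi (M.c t)) * A' + M.f t)) +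
        t * (M.f t / (-M.f (inv g lo hi (M.c t)) * A' + M.f t))

/-- The two matching functions `g₁ : [0,θbar] → [θ*,c(1)]` and `g₂ : [θlow,θ*] → [θ*,c(1)]`. As
decreasing bijections they satisfy `g₁(0) = c(1)` and `g₂(θ*) = θ*`. -/
structure IsMatchingPair (g₁ g₂ : ℝ → ℝ) (θbar θlow : ℝ) : Prop where
  first : M.IsMatching g₁ 0 θbar
  second : M.IsMatching g₂ θlow M.θs

/-- The posterior mean to which the pool-reveal-pool distribution with parameter `x` assigns the
type `θ`, where `θ₁ = g₁⁻¹(x)` and `θ₂ = g₂⁻¹(x)`. -/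
def namMap (g₁ g₂ : ℝ → ℝ) (θbar θlow x θ : ℝ) : ℝ :=
  if θ ≤ inv g₁ 0 θbar x then g₁ θ
  else if θ < inv g₂ θlow M.θs x then θ
  else if θ ≤ M.θs then g₂ θ
  else M.c θ

/-- The pool-reveal-pool negative assortative matching distribution `π^{x-NAM}`, that is,
`f(θ) δ_{namMap θ}(dx) dθ`. -/
def nam (g₁ g₂ : ℝ → ℝ) (θbar θlow x : ℝ) : Measure (ℝ × ℝ) :=
  M.prior.map fun θ => (θ, M.namMap g₁ g₂ θbar θlow x θ)

instance (g₁ g₂ : ℝ → ℝ) (θbar θlow x : ℝ) : IsFiniteMeasure (M.nam g₁ g₂ θbar θlow x) := by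
  unfold nam; infer_instance

end Market

end

/-! Why the pool-reveal-pool distribution is the unique solution.

*Pools.* In the variable `x = c(t)` a matching function `g` is a curve `A(t) = g⁻¹(c(t))` of
inefficient types that solves `(c(t) - A) f(A) A' = -(t - c(t)) f(t)`. It is locally Lipschitz
in `A` away from the single point `t = A = θ*`. Its solutions with `A(θ*) = b < θ*` do not cross
and increase with `b`; their limit as `b` tends to `θ*` is the second matching, which starts at
the singular point (`exists_singular_solution`). If it reached the type `0` at some `t ≤ 1`, its
pools, completed by revealing the types above `t`, would make everybody trade
(`NoFullTrade.false_of_isPooling`). Hence it ends above `0`, and a nonsingular solution below it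
ends exactly at `0`: the first matching. Any given pair is ordered in the same way, because
trajectories do not cross (`NoFullTrade.cutoffs`).

*Duality.* The martingale condition is priced by a multiplier: a type `θ` with posterior mean `x`
pays `p(x)(x - θ)`, and these payments have mean zero. If under some assignment `T` almost every
type strictly prefers its own posterior mean at these prices, then integrating the utility gap
shows that `T` is the unique solution (`Supports.isSolution_and_unique`). Here `p` solves `p'/p =
-1/(x - a(x))`, where `a(x)` is the inefficient type pooled at `x`, so the payment of `θ` is
single-dipped in `x` with minimum where `a(x) = θ` (`multiplier_mul_sub_lt`); and `p` is
decreasing, so efficient types choose the lowest mean available, their cost. The parameter `x` and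
the scale of `p` are such that both cutoff types are indifferent between trading and not; strict
convexity of `α(θ)/(x - θ)` then makes exactly the types between them stay out
(`OrderedCutoffs.supports`), and the boundary inequality on `α` yields such an `x` by the
intermediate value theorem (`exists_indifferent`).

The multiplier may explode at `θ*`, so it need not be integrable against a feasible distribution.
The integrations are therefore carried out away from `θ*`, and the limit is taken by monotonicity
of the gap. -/

namespace Market

open scoped NNReal Topology

variable (M : Market)

/-! ### The market primitives -/

lemma θs_pos : 0 < M.θs := M.θs_mem.1

lemma θs_lt_one : M.θs < 1 := M.θs_mem.2

lemma c_le_self {t : ℝ} (ht : t ∈ Icc M.θs 1) : M.c t ≤ t := by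
  rcases eq_or_lt_of_le ht.1 with h | h
  · rw [← h, M.c_θs]
  · exact (M.c_above t ⟨h, ht.2⟩).le

lemma mem_Icc_zero_one {t : ℝ} (ht : t ∈ Icc M.θs 1) : t ∈ Icc (0 : ℝ) 1 :=
  ⟨M.θs_pos.le.trans ht.1, ht.2⟩

lemma c_strictMonoOn_top : StrictMonoOn M.c (Icc M.θs 1) :=
  M.c_strictMono.mono fun _ => M.mem_Icc_zero_one

lemma θs_le_c {t : ℝ} (ht : t ∈ Icc M.θs 1) : M.θs ≤ M.c t := by
  have := M.c_strictMonoOn_top.monotoneOn ⟨le_rfl, M.θs_lt_one.le⟩ ht ht.1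
  rwa [M.c_θs] at this

lemma θs_lt_c {t : ℝ} (ht : t ∈ Ioc M.θs 1) : M.θs < M.c t := by
  have := M.c_strictMonoOn_top ⟨le_rfl, M.θs_lt_one.le⟩ ⟨ht.1.le, ht.2⟩ ht.1
  rwa [M.c_θs] at this

lemma c_one_lt_one : M.c 1 < 1 := M.c_above 1 ⟨M.θs_lt_one, le_rfl⟩

lemma θs_lt_c_one : M.θs < M.c 1 := M.θs_lt_c ⟨M.θs_lt_one, le_rfl⟩

lemma c_continuousOn : ContinuousOn M.c (Icc 0 1) := M.c_contDiff.continuousOn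

lemma f_continuousOn : ContinuousOn M.f (Icc 0 1) := M.f_contDiff.continuousOn

lemma c_continuousOn_top : ContinuousOn M.c (Icc M.θs 1) :=
  M.c_continuousOn.mono fun _ => M.mem_Icc_zero_one

lemma c_bijOn : BijOn M.c (Icc M.θs 1) (Icc M.θs (M.c 1)) := by
  refine ⟨fun t ht => ⟨M.θs_le_c ht, M.c_strictMonoOn_top.monotoneOn ht
    ⟨M.θs_lt_one.le, le_rfl⟩ ht.2⟩, M.c_strictMonoOn_top.injOn, ?_⟩
  have := intermediate_value_Icc M.θs_lt_one.le M.c_continuousOn_top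
  rwa [M.c_θs] at this

lemma exists_f_bounds : ∃ m K : ℝ, 0 < m ∧ 0 < K ∧ ∀ θ ∈ Icc (0 : ℝ) 1, m ≤ M.f θ ∧ M.f θ ≤ K := by
  obtain ⟨a, ha, hmin⟩ := isCompact_Icc.exists_isMinOn (nonempty_Icc.2 zero_le_one) M.f_continuousOn
  obtain ⟨b, hb, hmax⟩ := isCompact_Icc.exists_isMaxOn (nonempty_Icc.2 zero_le_one) M.f_continuousOn
  exact ⟨M.f a, M.f b, M.f_pos a ha, M.f_pos b hb, fun θ hθ => ⟨hmin hθ, hmax hθ⟩⟩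

lemma exists_f_lipschitz : ∃ L : ℝ, 0 ≤ L ∧ ∀ θ ∈ Icc (0 : ℝ) 1, ∀ η ∈ Icc (0 : ℝ) 1,
    |M.f θ - M.f η| ≤ L * |θ - η| := by
  have hloc : LocallyLipschitzOn (Icc (0 : ℝ) 1) M.f :=
    M.f_contDiff.locallyLipschitzOn (convex_Icc 0 1)
  obtain ⟨L, hL⟩ := hloc.exists_lipschitzOnWith_of_compact isCompact_Icc
  exact ⟨L, L.2, fun θ hθ η hη => by simpa [Real.dist_eq] using hL.dist_le_mul θ hθ η hη⟩

/-! ### The pooling differential equation -/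

/-- The slope `A'(t)` with which the inefficient type `a = A(t)` must move so that pooling it with
the efficient type `t` gives the posterior mean `c(t)`, i.e.
`(c(t) - A) f(A) A' = -(t - c(t)) f(t)`. -/
noncomputable def poolingSlope (t a : ℝ) : ℝ := -((t - M.c t) * M.f t) / ((M.c t - a) * M.f a)

/-- The pooling slope with the inefficient type clamped to `[0, β]`. For `β < c(s)` it is a globally
Lipschitz and bounded field on the times `[s, 1]`. -/
noncomputable def clampedSlope (β t a : ℝ) : ℝ := M.poolingSlope t (max 0 (min a β))

lemma poolingSlope_neg {t a : ℝ} (ht : t ∈ Ioc M.θs 1) (ha : a ∈ Icc 0 M.θs) :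
    M.poolingSlope t a < 0 := by
  have h1 := M.c_above t ht
  have h2 := M.θs_lt_c ht
  have h3 := M.f_pos t (M.mem_Icc_zero_one ⟨ht.1.le, ht.2⟩)
  have h4 := M.f_pos a ⟨ha.1, ha.2.trans M.θs_lt_one.le⟩
  have h5 := ha.2
  unfold poolingSlope
  exact div_neg_of_neg_of_pos (neg_neg_of_pos (mul_pos (by linarith) h3))
    (mul_pos (by linarith) h4)

lemma clamp_mem {β : ℝ} (hβ0 : 0 ≤ β) (a : ℝ) : max 0 (min a β) ∈ Icc 0 β :=
  ⟨le_max_left _ _, max_le hβ0 (min_le_right _ _)⟩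

lemma abs_clamp_sub_clamp_le (β a b : ℝ) : |max 0 (min a β) - max 0 (min b β)| ≤ |a - b| :=
  ((abs_max_sub_max_le_max 0 _ 0 _).trans (by simp)).trans
    ((abs_min_sub_min_le_max a β b β).trans (by simp))

lemma clampedSlope_nonpos {β t : ℝ} (hβ0 : 0 ≤ β) (hβ : β ≤ M.θs) (ht : t ∈ Icc M.θs 1) (a : ℝ) :
    M.clampedSlope β t a ≤ 0 := by
  have hk := clamp_mem hβ0 a
  rcases eq_or_lt_of_le ht.1 with h | h
  · simp [clampedSlope, poolingSlope, ← h, M.c_θs]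
  · exact (M.poolingSlope_neg ⟨h, ht.2⟩ ⟨hk.1, hk.2.trans hβ⟩).le

lemma clampedSlope_lipschitz_bounded {β s : ℝ} (hβ0 : 0 ≤ β) (hs : s ∈ Icc M.θs 1)
    (hβs : β < M.c s) :
    ∃ K L : ℝ≥0, ∀ t ∈ Icc s 1, LipschitzWith K (M.clampedSlope β t) ∧
      ∀ a, ‖M.clampedSlope β t a‖ ≤ L := by
  obtain ⟨m, F, hm, hF, hf⟩ := M.exists_f_bounds
  obtain ⟨L, hL0, hL⟩ := M.exists_f_lipschitz
  set d := M.c s - β with hd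
  have hd0 : 0 < d := sub_pos.2 hβs
  have hc1 : M.c s ≤ 1 := (M.c_le_self hs).trans hs.2
  have key : ∀ t ∈ Icc s 1, |(t - M.c t) * M.f t| ≤ F ∧ ∀ k ∈ Icc 0 β,
      d * m ≤ (M.c t - k) * M.f k ∧ ∀ l ∈ Icc 0 β,
      |(M.c t - k) * M.f k - (M.c t - l) * M.f l| ≤ (F + L) * |k - l| := by
    intro t ht
    have ht' : t ∈ Icc M.θs 1 := ⟨hs.1.trans ht.1, ht.2⟩
    have h0 := M.c_le_self ht'
    have h1 := M.c_strictMonoOn_top.monotoneOn hs ht' ht.1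
    have h2 := M.θs_le_c ht'
    have hθ := M.θs_pos
    have hft := hf t (M.mem_Icc_zero_one ht')
    refine ⟨?_, fun k hk => ?_⟩
    · rw [abs_of_nonneg (mul_nonneg (by linarith) (hm.le.trans hft.1))]
      calc (t - M.c t) * M.f t ≤ 1 * F :=
            mul_le_mul (by linarith [ht.2]) hft.2 (hm.le.trans hft.1) zero_le_one
        _ = F := one_mul F
    have hk1 : k ∈ Icc (0 : ℝ) 1 := ⟨hk.1, by linarith [hk.2]⟩
    have hfk := hf k hk1
    refine ⟨mul_le_mul (by linarith [hk.2]) hfk.1 hm.le (by linarith [hk.2]), fun l hl => ?_⟩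
    have hl1 : l ∈ Icc (0 : ℝ) 1 := ⟨hl.1, by linarith [hl.2]⟩
    have e : (M.c t - k) * M.f k - (M.c t - l) * M.f l
        = (l - k) * M.f k + (M.c t - l) * (M.f k - M.f l) := by ring
    rw [e]
    refine (abs_add_le _ _).trans ?_
    rw [abs_mul, abs_mul, add_mul, abs_sub_comm l k, mul_comm F,
      abs_of_pos (M.f_pos k hk1)]
    refine add_le_add (mul_le_mul_of_nonneg_left hfk.2 (abs_nonneg _)) ?_
    have : |M.c t - l| ≤ 1 := abs_le.2 ⟨by linarith [hl.2], by linarith [hl.1, ht.2]⟩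
    calc |M.c t - l| * |M.f k - M.f l| ≤ 1 * (L * |k - l|) :=
          mul_le_mul this (hL k hk1 l hl1) (abs_nonneg _) zero_le_one
      _ = L * |k - l| := one_mul _
  have hdm : 0 < d * m := mul_pos hd0 hm
  refine ⟨Real.toNNReal (F * (F + L) / (d * m) ^ 2), Real.toNNReal (F / (d * m)), fun t ht => ?_⟩
  obtain ⟨hn, hk⟩ := key t ht
  refine ⟨LipschitzWith.of_dist_le_mul fun a b => ?_, fun a => ?_⟩
  · have ha := hk _ (clamp_mem hβ0 a)
    have hb := hk _ (clamp_mem hβ0 b)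
    have hab := (hb.2 _ (clamp_mem hβ0 a)).trans
      (mul_le_mul_of_nonneg_left (abs_clamp_sub_clamp_le β b a) (by positivity))
    rw [Real.coe_toNNReal _ (by positivity), Real.dist_eq, Real.dist_eq, clampedSlope, clampedSlope,
      poolingSlope, poolingSlope]
    set u := (M.c t - max 0 (min a β)) * M.f (max 0 (min a β))
    set v := (M.c t - max 0 (min b β)) * M.f (max 0 (min b β))
    have hu : 0 < u := hdm.trans_le ha.1
    have hv : 0 < v := hdm.trans_le hb.1
    have e : -((t - M.c t) * M.f t) / u - -((t - M.c t) * M.f t) / v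
        = -((t - M.c t) * M.f t) * (v - u) / (u * v) := by field_simp; ring
    rw [e, abs_div, abs_mul, abs_neg, abs_of_pos (mul_pos hu hv), abs_sub_comm a b]
    calc |(t - M.c t) * M.f t| * |v - u| / (u * v)
        ≤ F * ((F + L) * |b - a|) / (d * m) ^ 2 := by
          have := ha.1
          have := hb.1
          gcongr
          rw [sq]
          gcongr
      _ = F * (F + L) / (d * m) ^ 2 * |b - a| := by ring
  · rw [Real.coe_toNNReal _ (by positivity), Real.norm_eq_abs, clampedSlope, poolingSlope, abs_div,
      abs_neg]
    have ha := (hk _ (clamp_mem hβ0 a)).1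
    rw [abs_of_pos (hdm.trans_le ha)]
    gcongr

lemma clampedSlope_continuousOn {β s : ℝ} (hβ0 : 0 ≤ β) (hs : s ∈ Icc M.θs 1)
    (hβs : β < M.c s) (a : ℝ) : ContinuousOn (fun t => M.clampedSlope β t a) (Icc s 1) := by
  have hsub : Icc s 1 ⊆ Icc (0 : ℝ) 1 := fun t ht => M.mem_Icc_zero_one ⟨hs.1.trans ht.1, ht.2⟩
  have hc := M.c_continuousOn.mono hsub
  have hf := M.f_continuousOn.mono hsub
  have hk := clamp_mem hβ0 a
  have hc1 : M.c s ≤ 1 := (M.c_le_self hs).trans hs.2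
  refine ContinuousOn.div ((continuousOn_id.sub hc).mul hf).neg
    ((hc.sub continuousOn_const).mul continuousOn_const) fun t ht => ?_
  have h1 := M.c_strictMonoOn_top.monotoneOn hs ⟨hs.1.trans ht.1, ht.2⟩ ht.1
  exact mul_ne_zero (by linarith [hk.2]) (M.f_pos _ ⟨hk.1, by linarith [hk.2]⟩).ne'

/-- `A` solves the clamped pooling equation on `[s, 1]`. -/
def IsClampedSolution (β s : ℝ) (A : ℝ → ℝ) : Prop :=
  ∀ t ∈ Icc s 1, HasDerivWithinAt A (M.clampedSlope β t (A t)) (Icc s 1) t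

variable {M}

lemma exists_isClampedSolution {β s : ℝ} (hβ0 : 0 ≤ β) (hs : s ∈ Icc M.θs 1) (hβs : β < M.c s)
    {t₀ : ℝ} (ht₀ : t₀ ∈ Icc s 1) (a₀ : ℝ) :
    ∃ A, A t₀ = a₀ ∧ M.IsClampedSolution β s A := by
  obtain ⟨K, L, h⟩ := M.clampedSlope_lipschitz_bounded hβ0 hs hβs
  have hP : IsPicardLindelof (M.clampedSlope β) (⟨t₀, ht₀⟩ : Icc s 1) a₀ L 0 L K :=
    { lipschitzOnWith := fun t ht => (h t ht).1.lipschitzOnWith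
      continuousOn := fun a _ => M.clampedSlope_continuousOn hβ0 hs hβs a
      norm_le := fun t ht a _ => (h t ht).2 a
      mul_max_le := by
        have h0 := M.θs_pos
        have : max (1 - t₀) (t₀ - s) ≤ 1 :=
          max_le (by linarith [ht₀.1, hs.1]) (by linarith [ht₀.2, hs.1])
        simpa using mul_le_mul_of_nonneg_left this L.2 }
  exact hP.exists_eq_forall_mem_Icc_hasDerivWithinAt₀

namespace IsClampedSolution

variable {β s : ℝ} {A B : ℝ → ℝ}

lemma continuousOn (hA : M.IsClampedSolution β s A) : ContinuousOn A (Icc s 1) :=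
  fun t ht => (hA t ht).continuousWithinAt

lemma hasDerivWithinAt_Ici (hA : M.IsClampedSolution β s A) {u t : ℝ} (hu : u ≤ 1)
    (ht : t ∈ Ico s u) : HasDerivWithinAt A (M.clampedSlope β t (A t)) (Ici t) t :=
  (hA t ⟨ht.1, ht.2.le.trans hu⟩).mono_of_mem_nhdsWithin
    (Filter.mem_of_superset (Icc_mem_nhdsGE (ht.2.trans_le hu)) (Icc_subset_Icc_left ht.1))

lemma hasDerivWithinAt_Iic (hA : M.IsClampedSolution β s A) {t : ℝ}
    (ht : t ∈ Ioc s 1) : HasDerivWithinAt A (M.clampedSlope β t (A t)) (Iic t) t :=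
  (hA t ⟨ht.1.le, ht.2⟩).mono_of_mem_nhdsWithin
    (Filter.mem_of_superset (Icc_mem_nhdsLE ht.1) (Icc_subset_Icc_right ht.2))

lemma antitoneOn (hA : M.IsClampedSolution β s A) (hβ0 : 0 ≤ β) (hβ : β ≤ M.θs)
    (hs : M.θs ≤ s) : AntitoneOn A (Icc s 1) := by
  refine antitoneOn_of_hasDerivWithinAt_nonpos (convex_Icc s 1) hA.continuousOn
    (fun t ht => (hA t (interior_subset ht)).mono interior_subset) fun t ht => ?_
  have ht := interior_subset ht
  exact M.clampedSlope_nonpos hβ0 hβ ⟨hs.trans ht.1, ht.2⟩ _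

lemma mono_left (hA : M.IsClampedSolution β s A) {s' : ℝ} (h : s ≤ s') :
    M.IsClampedSolution β s' A := fun t ht =>
  (hA t ⟨h.trans ht.1, ht.2⟩).mono (Icc_subset_Icc_left h)

/-- Raising the clamp above the range of a solution changes nothing. -/
lemma of_le (hA : M.IsClampedSolution β s A) {β' : ℝ} (h : β ≤ β')
    (hle : ∀ t ∈ Icc s 1, A t ≤ β) : M.IsClampedSolution β' s A := by
  intro t ht
  have := hA t ht
  rwa [clampedSlope, min_eq_left (hle t ht), ← min_eq_left ((hle t ht).trans h)] at this

lemma eqOn (hA : M.IsClampedSolution β s A) (hB : M.IsClampedSolution β s B) (hβ0 : 0 ≤ β)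
    (hs : s ∈ Icc M.θs 1) (hβs : β < M.c s) {t₀ : ℝ} (ht₀ : t₀ ∈ Icc s 1) (h : A t₀ = B t₀) :
    EqOn A B (Icc s 1) := by
  obtain ⟨K, L, hK⟩ := M.clampedSlope_lipschitz_bounded hβ0 hs hβs
  rw [← Icc_union_Icc_eq_Icc ht₀.1 ht₀.2]
  have h1 : Icc s t₀ ⊆ Icc s 1 := Icc_subset_Icc_right ht₀.2
  have h2 : Icc t₀ 1 ⊆ Icc s 1 := Icc_subset_Icc_left ht₀.1
  refine EqOn.union ?_ ?_
  · exact ODE_solution_unique_of_mem_Icc_left (v := M.clampedSlope β) (s := fun _ => univ)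
      (fun t ht => (hK t (h1 ⟨ht.1.le, ht.2⟩)).1.lipschitzOnWith) (hA.continuousOn.mono h1)
      (fun t ht => hA.hasDerivWithinAt_Iic ⟨ht.1, ht.2.trans ht₀.2⟩) (fun _ _ => mem_univ _)
      (hB.continuousOn.mono h1)
      (fun t ht => hB.hasDerivWithinAt_Iic ⟨ht.1, ht.2.trans ht₀.2⟩) (fun _ _ => mem_univ _) h
  · exact ODE_solution_unique_of_mem_Icc_right (v := M.clampedSlope β) (s := fun _ => univ)
      (fun t ht => (hK t (h2 ⟨ht.1, ht.2.le⟩)).1.lipschitzOnWith) (hA.continuousOn.mono h2)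
      (fun t ht => hA.hasDerivWithinAt_Ici le_rfl ⟨ht₀.1.trans ht.1, ht.2⟩) (fun _ _ => mem_univ _)
      (hB.continuousOn.mono h2)
      (fun t ht => hB.hasDerivWithinAt_Ici le_rfl ⟨ht₀.1.trans ht.1, ht.2⟩)
      (fun _ _ => mem_univ _) h

/-- Trajectories do not cross. -/
lemma lt_of_lt (hA : M.IsClampedSolution β s A) (hB : M.IsClampedSolution β s B) (hβ0 : 0 ≤ β)
    (hs : s ∈ Icc M.θs 1) (hβs : β < M.c s) {t₀ : ℝ} (ht₀ : t₀ ∈ Icc s 1) (h : A t₀ < B t₀)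
    {t : ℝ} (ht : t ∈ Icc s 1) : A t < B t := by
  by_contra! hle
  have hsub : uIcc t₀ t ⊆ Icc s 1 := by
    rw [uIcc]; exact Icc_subset_Icc (le_inf ht₀.1 ht.1) (sup_le ht₀.2 ht.2)
  have hcont : ContinuousOn (fun r => A r - B r) (uIcc t₀ t) :=
    (hA.continuousOn.sub hB.continuousOn).mono hsub
  have hmem : (0 : ℝ) ∈ uIcc (A t₀ - B t₀) (A t - B t) :=
    mem_uIcc.2 (Or.inl ⟨by linarith, by linarith⟩)
  obtain ⟨r, hr, hr0⟩ := intermediate_value_uIcc hcont hmem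
  have := hA.eqOn hB hβ0 hs hβs (hsub hr) (sub_eq_zero.1 hr0) ht₀
  exact h.ne this

/-- Solutions depend continuously on the initial value, so a pointwise limit of solutions is a
solution. -/
lemma of_tendsto {An : ℕ → ℝ → ℝ} (hAn : ∀ n, M.IsClampedSolution β s (An n)) (hβ0 : 0 ≤ β)
    (hs : s ∈ Icc M.θs 1) (hβs : β < M.c s)
    (hlim : ∀ t ∈ Icc s 1, Filter.Tendsto (fun n => An n t) Filter.atTop (𝓝 (A t))) :
    M.IsClampedSolution β s A := by
  have hs1 : s ∈ Icc s 1 := ⟨le_rfl, hs.2⟩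
  obtain ⟨B, hB0, hB⟩ := exists_isClampedSolution hβ0 hs hβs hs1 (A s)
  obtain ⟨K, L, hK⟩ := M.clampedSlope_lipschitz_bounded hβ0 hs hβs
  have hAB : EqOn A B (Icc s 1) := by
    intro t ht
    have hd : ∀ n, dist (An n t) (B t) ≤ dist (An n s) (A s) * Real.exp (K * (t - s)) := by
      intro n
      exact dist_le_of_trajectories_ODE_of_mem (v := M.clampedSlope β) (s := fun _ => univ)
        (fun r hr => (hK r ⟨hr.1, hr.2.le⟩).1.lipschitzOnWith) (hAn n).continuousOn
        (fun r hr => (hAn n).hasDerivWithinAt_Ici le_rfl hr) (fun _ _ => mem_univ _)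
        hB.continuousOn (fun r hr => hB.hasDerivWithinAt_Ici le_rfl hr) (fun _ _ => mem_univ _)
        (by rw [hB0]) t ht
    have h0 : Filter.Tendsto (fun n => dist (An n s) (A s) * Real.exp (K * (t - s)))
        Filter.atTop (𝓝 0) := by
      simpa using (tendsto_iff_dist_tendsto_zero.1 (hlim s hs1)).mul_const _
    exact tendsto_nhds_unique (hlim t ht)
      (tendsto_iff_dist_tendsto_zero.2 (squeeze_zero (fun _ => dist_nonneg) hd h0))
  intro t ht
  have := (hB t ht).congr (fun r hr => hAB hr) (hAB ht)
  rwa [← hAB ht] at this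

end IsClampedSolution

/-! ### Integrals against the prior -/

lemma prior_absolutelyContinuous (M : Market) : M.prior ≪ volume :=
  (withDensity_absolutelyContinuous _ _).trans Measure.absolutelyContinuous_restrict

lemma ae_prior_mem_Icc (M : Market) : ∀ᵐ θ ∂M.prior, θ ∈ Icc (0 : ℝ) 1 :=
  (withDensity_absolutelyContinuous _ _).ae_le (ae_restrict_mem measurableSet_Icc)

lemma ae_prior_ne (M : Market) (a : ℝ) : ∀ᵐ θ ∂M.prior, θ ≠ a :=
  M.prior_absolutelyContinuous.ae_le (Measure.ae_ne volume a)

lemma prior_restrict_Icc (M : Market) : M.prior.restrict (Icc 0 1) = M.prior :=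
  Measure.restrict_eq_self_of_ae_mem M.ae_prior_mem_Icc

lemma setIntegral_prior (M : Market) {S : Set ℝ} (hS : MeasurableSet S) (hS01 : S ⊆ Icc 0 1)
    (h : ℝ → ℝ) : ∫ θ in S, h θ ∂M.prior = ∫ θ in S, M.f θ * h θ := by
  have hf : AEMeasurable (fun θ => ENNReal.ofReal (M.f θ)) (volume.restrict S) :=
    ((M.f_continuousOn.mono hS01).aemeasurable hS).ennreal_ofReal
  have hres : (volume.restrict (Icc (0 : ℝ) 1)).restrict S = volume.restrict S := by
    rw [Measure.restrict_restrict hS, inter_eq_left.2 hS01]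
  rw [prior, setIntegral_withDensity_eq_setIntegral_toReal_smul₀ (by rwa [hres])
    (Filter.Eventually.of_forall fun _ => ENNReal.ofReal_lt_top) _ hS, hres]
  refine setIntegral_congr_fun hS fun θ hθ => ?_
  simp only [smul_eq_mul, ENNReal.toReal_ofReal (M.f_pos θ (hS01 hθ)).le]

lemma exists_measurable_eqOn_c (M : Market) : ∃ d : ℝ → ℝ, Measurable d ∧ EqOn d M.c (Icc 0 1) := by
  have hc : Continuous (IccExtend zero_le_one ((Icc (0 : ℝ) 1).domRestrict M.c)) :=
    (continuousOn_iff_continuous_domRestrict.1 M.c_continuousOn).Icc_extend'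
  exact ⟨_, hc.measurable, fun t ht => by rw [IccExtend_of_mem _ _ ht]; rfl⟩

lemma measurableSet_inter_preimage_c (M : Market) {E B : Set ℝ} (hE : MeasurableSet E)
    (hE01 : E ⊆ Icc 0 1) (hB : MeasurableSet B) : MeasurableSet (E ∩ M.c ⁻¹' B) := by
  obtain ⟨d, hd, hdc⟩ := M.exists_measurable_eqOn_c
  have e : E ∩ M.c ⁻¹' B = E ∩ d ⁻¹' B := by
    ext t
    refine and_congr_right fun ht => ?_
    rw [mem_preimage, mem_preimage, hdc (hE01 ht)]
  rw [e]
  exact hE.inter (hd hB)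

/-! ### Feasibility of deterministic assignments of posterior means -/

/-- The types in `S` balance: among those with posterior mean in any given `B`, the mean of the type
is the mean of the posterior mean. -/
def Balanced (M : Market) (T : ℝ → ℝ) (S : Set ℝ) : Prop :=
  MeasurableSet S ∧ ∀ B, MeasurableSet B → ∫ θ in T ⁻¹' B ∩ S, (T θ - θ) ∂M.prior = 0

lemma integrable_sub_id {T : ℝ → ℝ} (hT : AEMeasurable T M.prior)
    (hT01 : ∀ᵐ θ ∂M.prior, T θ ∈ Icc (0 : ℝ) 1) : Integrable (fun θ => T θ - θ) M.prior := by
  refine Integrable.of_bound (hT.sub aemeasurable_id).aestronglyMeasurable 1 ?_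
  filter_upwards [hT01, M.ae_prior_mem_Icc] with θ h1 h2
  rw [Real.norm_eq_abs, abs_le]
  exact ⟨by linarith [h1.1, h2.2], by linarith [h1.2, h2.1]⟩

lemma Balanced.union {T : ℝ → ℝ} {S S' : Set ℝ} (h : M.Balanced T S) (h' : M.Balanced T S')
    (hd : Disjoint S S') (hint : Integrable (fun θ => T θ - θ) M.prior) :
    M.Balanced T (S ∪ S') := by
  refine ⟨h.1.union h'.1, fun B hB => ?_⟩
  rw [← integral_inter_add_sdiff h.1 hint.integrableOn, inter_assoc,
    inter_eq_right.2 (subset_union_left : S ⊆ S ∪ S'), h.2 B hB, inter_sdiff_assoc,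
    union_sdiff_left, hd.symm.sdiff_eq_left, h'.2 B hB, add_zero]

lemma Balanced.setIntegral_eq_zero {T : ℝ → ℝ} {S : Set ℝ} (h : M.Balanced T S)
    (hint : Integrable (fun θ => T θ - θ) M.prior)
    (hid : ∀ᵐ θ ∂M.prior, θ ∉ S → T θ = θ) {B : Set ℝ} (hB : MeasurableSet B) :
    ∫ θ in T ⁻¹' B, (T θ - θ) ∂M.prior = 0 := by
  rw [← integral_inter_add_sdiff h.1 hint.integrableOn, h.2 B hB, zero_add, sdiff_eq,
    inter_comm, ← Measure.restrict_restrict h.1.compl]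
  refine integral_eq_zero_of_ae ?_
  refine (ae_restrict_iff' h.1.compl).2 (ae_restrict_of_ae ?_)
  filter_upwards [hid] with θ hθ hS
  simp [hθ hS]

lemma feasible_map {T : ℝ → ℝ} (hT : AEMeasurable T M.prior)
    (hT01 : ∀ᵐ θ ∂M.prior, T θ ∈ Icc (0 : ℝ) 1) (hcost : ∀ᵐ θ ∂M.prior, M.auxCost θ ≤ T θ)
    {S : Set ℝ} (hS : M.Balanced T S) (hid : ∀ᵐ θ ∂M.prior, θ ∉ S → T θ = θ) :
    M.Feasible (M.prior.map fun θ => (θ, T θ)) := by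
  have hpair : AEMeasurable (fun θ => (θ, T θ)) M.prior := aemeasurable_id.prodMk hT
  constructor
  · exact Measure.isProbabilityMeasure_map hpair
  · refine (ae_map_iff hpair (measurableSet_Icc.prod measurableSet_Icc)).2 ?_
    filter_upwards [hT01, M.ae_prior_mem_Icc] with θ h1 h2 using ⟨h2, h1⟩
  · intro A hA
    rw [Measure.map_apply_of_aemeasurable hpair (hA.prod MeasurableSet.univ)]
    congr 1
    ext θ
    simp
  · intro B hB
    have hm : Measurable fun z : ℝ × ℝ => z.2 - z.1 := measurable_snd.sub measurable_fst
    rw [setIntegral_map (MeasurableSet.univ.prod hB) hm.aestronglyMeasurable hpair]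
    have e : (fun θ => (θ, T θ)) ⁻¹' (univ ×ˢ B) = T ⁻¹' B := by ext θ; simp
    rw [e]
    exact hS.setIntegral_eq_zero (integrable_sub_id hT hT01) hid hB
  · intro B hB
    have hnull : ∀ᵐ θ ∂M.prior, ¬ T θ < M.auxCost θ := by
      filter_upwards [hcost] with θ h using not_lt.2 h
    -- The set need not be measurable, as `c` is arbitrary off `[0,1]`: enlarge it to one that is.
    obtain ⟨d, hcm, hd⟩ := M.exists_measurable_eqOn_c
    have hms : MeasurableSet ({z : ℝ × ℝ | z.1 ∉ Icc (0 : ℝ) 1} ∪ {z | z.2 < min z.1 (d z.1)}) := by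
      refine (measurable_fst measurableSet_Icc.compl).union (measurableSet_lt measurable_snd ?_)
      exact measurable_fst.min (hcm.comp measurable_fst)
    refine measure_mono_null (t := {z : ℝ × ℝ | z.1 ∉ Icc (0 : ℝ) 1} ∪
      {z | z.2 < min z.1 (d z.1)}) ?_ ?_
    · rintro z ⟨-, hz⟩
      by_cases h : z.1 ∈ Icc (0 : ℝ) 1
      · right
        simp only [mem_ofPred_eq, hd h]
        exact hz
      · exact Or.inl h
    · rw [Measure.map_apply_of_aemeasurable hpair hms]
      refine measure_mono_null (t := {θ | ¬ (θ ∈ Icc (0 : ℝ) 1 ∧ ¬ T θ < M.auxCost θ)}) ?_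
        (M.ae_prior_mem_Icc.and hnull)
      rintro θ (h | h) ⟨h1, h2⟩
      · exact h h1
      · simp only [mem_ofPred_eq, hd h1] at h
        exact h2 h

/-! ### Pools along a solution of the pooling equation -/

/-- `A` assigns to each efficient type `t ∈ [θ*, u]` the inefficient type `A(t)` with which it is
pooled at the posterior mean `c(t)`. -/
structure IsPooling (M : Market) (A : ℝ → ℝ) (u : ℝ) : Prop where
  mem : u ∈ Ioc M.θs 1
  continuousOn : ContinuousOn A (Icc M.θs u)
  mapsTo : MapsTo A (Icc M.θs u) (Icc 0 M.θs)
  hasDeriv : ∀ t ∈ Ioc M.θs u, HasDerivWithinAt A (M.poolingSlope t (A t)) (Icc M.θs u) t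

namespace IsPooling

variable {A : ℝ → ℝ} {u : ℝ}

lemma strictAntiOn (hA : M.IsPooling A u) : StrictAntiOn A (Icc M.θs u) := by
  refine strictAntiOn_of_hasDerivWithinAt_neg (f' := fun t => M.poolingSlope t (A t))
    (convex_Icc _ _) hA.continuousOn (fun t ht => ?_) fun t ht => ?_
  all_goals rw [interior_Icc] at ht
  · exact (hA.hasDeriv t ⟨ht.1, ht.2.le⟩).mono interior_subset
  · exact M.poolingSlope_neg ⟨ht.1, ht.2.le.trans hA.mem.2⟩ (hA.mapsTo ⟨ht.1.le, ht.2.le⟩)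

lemma bijOn (hA : M.IsPooling A u) : BijOn A (Icc M.θs u) (Icc (A u) (A M.θs)) := by
  have hle := hA.mem.1.le
  refine ⟨fun t ht => ⟨hA.strictAntiOn.antitoneOn ht ⟨hle, le_rfl⟩ ht.2,
    hA.strictAntiOn.antitoneOn ⟨le_rfl, hle⟩ ht ht.1⟩, hA.strictAntiOn.injOn, ?_⟩
  exact intermediate_value_Icc' hle hA.continuousOn

lemma image_Ioc (hA : M.IsPooling A u) {s t : ℝ} (hs : s ∈ Icc M.θs u) (ht : t ∈ Icc M.θs u)
    (hst : s ≤ t) : A '' Ioc s t = Ico (A t) (A s) := by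
  have hsub : Icc s t ⊆ Icc M.θs u := Icc_subset_Icc hs.1 ht.2
  refine Subset.antisymm ?_ fun θ hθ => ?_
  · rintro _ ⟨r, hr, rfl⟩
    have hr' := hsub ⟨hr.1.le, hr.2⟩
    exact ⟨hA.strictAntiOn.antitoneOn hr' ht hr.2, hA.strictAntiOn hs hr' hr.1⟩
  · obtain ⟨r, hr, rfl⟩ :=
      intermediate_value_Icc' hst (hA.continuousOn.mono hsub) ⟨hθ.1, hθ.2.le⟩
    exact ⟨r, ⟨lt_of_le_of_ne hr.1 fun h => hθ.2.ne (by rw [h]), hr.2⟩, rfl⟩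

/-- Change of variables `θ = A(t)`: the mass of the pooled inefficient types is
`(t - c(t)) / (c(t) - A(t))` times the mass of the efficient types that they are pooled with. -/
lemma setIntegral_image (hA : M.IsPooling A u) {E : Set ℝ} (hE : MeasurableSet E)
    (hEsub : E ⊆ Ioc M.θs u) (h : ℝ → ℝ) :
    ∫ θ in A '' E, h θ ∂M.prior = ∫ t in E, (t - M.c t) / (M.c t - A t) * h (A t) ∂M.prior := by
  have hEcc : E ⊆ Icc M.θs u := hEsub.trans Ioc_subset_Icc_self
  have hE01 : E ⊆ Icc 0 1 := fun t ht =>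
    M.mem_Icc_zero_one ⟨(hEsub ht).1.le, (hEsub ht).2.trans hA.mem.2⟩
  have himg : MeasurableSet (A '' E) :=
    hE.image_of_continuousOn_injOn (hA.continuousOn.mono hEcc) (hA.strictAntiOn.injOn.mono hEcc)
  have himg01 : A '' E ⊆ Icc 0 1 := by
    rintro _ ⟨t, ht, rfl⟩
    have := hA.mapsTo (hEcc ht)
    exact ⟨this.1, this.2.trans M.θs_lt_one.le⟩
  rw [M.setIntegral_prior himg himg01, M.setIntegral_prior hE hE01,
    integral_image_eq_integral_abs_deriv_smul hE (fun t ht => (hA.hasDeriv t (hEsub ht)).mono hEcc)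
      (hA.strictAntiOn.injOn.mono hEcc)]
  refine setIntegral_congr_fun hE fun t ht => ?_
  have hAt := hA.mapsTo (hEcc ht)
  have ht' : t ∈ Ioc M.θs 1 := ⟨(hEsub ht).1, (hEsub ht).2.trans hA.mem.2⟩
  have h1 := M.f_pos (A t) (himg01 ⟨t, ht, rfl⟩)
  have h2 : 0 < M.c t - A t := by linarith [M.θs_lt_c ht', hAt.2]
  simp only [smul_eq_mul]
  rw [abs_of_neg (M.poolingSlope_neg ht' hAt), poolingSlope]
  field_simp

lemma balanced (hA : M.IsPooling A u) {T : ℝ → ℝ} {E : Set ℝ} (hE : MeasurableSet E)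
    (hEsub : E ⊆ Ioc M.θs u) (hTA : ∀ t ∈ E, T (A t) = M.c t) (hTE : ∀ t ∈ E, T t = M.c t)
    (hint : Integrable (fun θ => T θ - θ) M.prior) : M.Balanced T (A '' E ∪ E) := by
  have hEcc : E ⊆ Icc M.θs u := hEsub.trans Ioc_subset_Icc_self
  have hE01 : E ⊆ Icc 0 1 := fun t ht =>
    M.mem_Icc_zero_one ⟨(hEsub ht).1.le, (hEsub ht).2.trans hA.mem.2⟩
  have himg : ∀ E', MeasurableSet E' → E' ⊆ E → MeasurableSet (A '' E') := fun E' hE' hs =>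
    hE'.image_of_continuousOn_injOn (hA.continuousOn.mono (hs.trans hEcc))
      (hA.strictAntiOn.injOn.mono (hs.trans hEcc))
  refine ⟨(himg E hE subset_rfl).union hE, fun B hB => ?_⟩
  set E' := E ∩ M.c ⁻¹' B with hE'def
  have hE' : MeasurableSet E' := M.measurableSet_inter_preimage_c hE hE01 hB
  have hE'E : E' ⊆ E := inter_subset_left
  have e : T ⁻¹' B ∩ (A '' E ∪ E) = A '' E' ∪ E' := by
    ext θ
    constructor
    · rintro ⟨hθ, ⟨t, ht, rfl⟩ | ht⟩
      · exact Or.inl ⟨t, ⟨ht, by rwa [mem_preimage, hTA t ht] at hθ⟩, rfl⟩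
      · exact Or.inr ⟨ht, by rwa [mem_preimage, hTE θ ht] at hθ⟩
    · rintro (⟨t, ht, rfl⟩ | ht)
      · exact ⟨by rw [mem_preimage, hTA t ht.1]; exact ht.2, Or.inl ⟨t, ht.1, rfl⟩⟩
      · exact ⟨by rw [mem_preimage, hTE θ ht.1]; exact ht.2, Or.inr ht.1⟩
  have hd : Disjoint (A '' E') E' := by
    rw [disjoint_left]
    rintro _ ⟨t, ht, rfl⟩ h
    exact absurd (hA.mapsTo (hEcc ht.1)).2 (not_le.2 (hEsub h.1).1)
  rw [e, setIntegral_union hd hE' hint.integrableOn hint.integrableOn,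
    hA.setIntegral_image hE' (hE'E.trans hEsub), M.setIntegral_prior hE' (hE'E.trans hE01),
    M.setIntegral_prior hE' (hE'E.trans hE01)]
  have e2 : ∫ t in E', M.f t * ((t - M.c t) / (M.c t - A t) * (T (A t) - A t))
      = ∫ t in E', -(M.f t * (T t - t)) := by
    refine setIntegral_congr_fun hE' fun t ht => ?_
    have hAt := hA.mapsTo (hEcc ht.1)
    have ht' : t ∈ Ioc M.θs 1 := ⟨(hEsub ht.1).1, (hEsub ht.1).2.trans hA.mem.2⟩
    have h2 : M.c t - A t ≠ 0 := by linarith [M.θs_lt_c ht', hAt.2]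
    rw [hTA t ht.1, hTE t ht.1]
    field_simp
    ring
  rw [e2, integral_neg, neg_add_cancel]

end IsPooling

/-- If the pools along `A` exhaust all inefficient types, everybody can trade: pool
`t ∈ (θ*, u]` with `A(t)` and reveal the types above `u`. -/
lemma NoFullTrade.false_of_isPooling (hM : M.NoFullTrade) {A : ℝ → ℝ} {u : ℝ}
    (hA : M.IsPooling A u) (hbot : A M.θs = M.θs) (htop : A u = 0) : False := by
  set T : ℝ → ℝ := fun θ => if θ ≤ M.θs then M.c (Function.invFunOn A (Icc M.θs u) θ)
    else if θ ≤ u then M.c θ else θ with hTdef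
  have hu := hA.mem
  have hθ0 := M.θs_pos
  have hbij := hA.bijOn
  rw [hbot, htop] at hbij
  have hinv : ∀ θ ∈ Icc 0 M.θs, Function.invFunOn A (Icc M.θs u) θ ∈ Icc M.θs u ∧
      A (Function.invFunOn A (Icc M.θs u) θ) = θ := fun θ hθ =>
    ⟨Function.invFunOn_mem (hbij.surjOn hθ), Function.invFunOn_eq (hbij.surjOn hθ)⟩
  have hinvA : ∀ t ∈ Icc M.θs u, Function.invFunOn A (Icc M.θs u) (A t) = t := fun t ht =>
    hbij.injOn (hinv _ (hbij.mapsTo ht)).1 ht (hinv _ (hbij.mapsTo ht)).2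
  have hinv1 : ∀ θ ∈ Icc 0 M.θs, Function.invFunOn A (Icc M.θs u) θ ∈ Icc M.θs 1 := fun θ hθ =>
    ⟨(hinv θ hθ).1.1, (hinv θ hθ).1.2.trans hu.2⟩
  have hT1 : EqOn T (fun θ => M.c (Function.invFunOn A (Icc M.θs u) θ)) (Icc 0 M.θs) :=
    fun θ hθ => if_pos hθ.2
  have hT2 : EqOn T M.c (Ioc M.θs u) := fun θ hθ => by
    simp only [hTdef, if_neg (not_le.2 hθ.1), if_pos hθ.2]
  have hT3 : EqOn T id (Ioc u 1) := fun θ hθ => by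
    simp only [hTdef, if_neg (not_le.2 (hu.1.trans hθ.1)), if_neg (not_le.2 hθ.1), id]
  have hcover : Icc (0 : ℝ) 1 ⊆ Icc 0 M.θs ∪ (Ioc M.θs u ∪ Ioc u 1) := by
    intro θ hθ
    rw [Ioc_union_Ioc_eq_Ioc hu.1.le hu.2, Icc_union_Ioc_eq_Icc hθ0.le M.θs_lt_one.le]
    exact hθ
  have hTm : AEMeasurable T M.prior := by
    rw [← M.prior_restrict_Icc]
    refine AEMeasurable.mono_measure ?_ (Measure.restrict_mono hcover le_rfl)
    refine aemeasurable_union_iff.2 ⟨?_, aemeasurable_union_iff.2 ⟨?_, ?_⟩⟩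
    · refine aemeasurable_restrict_of_antitoneOn measurableSet_Icc ?_
      intro θ hθ η hη h
      rw [hT1 hθ, hT1 hη]
      refine M.c_strictMonoOn_top.monotoneOn (hinv1 η hη) (hinv1 θ hθ) ?_
      by_contra! hlt
      have := hA.strictAntiOn (hinv θ hθ).1 (hinv η hη).1 hlt
      rw [(hinv θ hθ).2, (hinv η hη).2] at this
      exact absurd h (not_le.2 this)
    · refine aemeasurable_restrict_of_monotoneOn measurableSet_Ioc ?_
      refine MonotoneOn.congr (M.c_strictMonoOn_top.monotoneOn.mono ?_) hT2.symm
      exact fun t ht => ⟨ht.1.le, ht.2.trans hu.2⟩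
    · exact aemeasurable_restrict_of_monotoneOn measurableSet_Ioc
        (MonotoneOn.congr (monotone_id.monotoneOn _) hT3.symm)
  have hge : ∀ θ ∈ Icc (0 : ℝ) 1, T θ ∈ Icc M.θs 1 ∧ M.auxCost θ ≤ T θ := by
    intro θ hθ
    rcases hcover hθ with h | h | h
    · rw [hT1 h]
      have h1 := hinv1 θ h
      have h2 := M.θs_le_c h1
      exact ⟨⟨h2, (M.c_le_self h1).trans h1.2⟩, (min_le_left _ _).trans (h.2.trans h2)⟩
    · rw [hT2 h]
      have h1 : θ ∈ Icc M.θs 1 := ⟨h.1.le, h.2.trans hu.2⟩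
      exact ⟨⟨M.θs_le_c h1, (M.c_le_self h1).trans h1.2⟩, min_le_right _ _⟩
    · rw [hT3 h]
      exact ⟨⟨(hu.1.trans h.1).le, h.2⟩, min_le_left _ _⟩
  have hT01 : ∀ᵐ θ ∂M.prior, T θ ∈ Icc (0 : ℝ) 1 := by
    filter_upwards [M.ae_prior_mem_Icc] with θ hθ
    exact ⟨hθ0.le.trans (hge θ hθ).1.1, (hge θ hθ).1.2⟩
  have hbal : M.Balanced T (A '' Ioc M.θs u ∪ Ioc M.θs u) := by
    refine hA.balanced measurableSet_Ioc subset_rfl (fun t ht => ?_) (fun t ht => hT2 ht)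
      (integrable_sub_id hTm hT01)
    have ht' := Ioc_subset_Icc_self ht
    rw [hT1 (hbij.mapsTo ht')]
    simp only [hinvA t ht']
  have himg : A '' Ioc M.θs u = Ico 0 M.θs := by
    rw [hA.image_Ioc ⟨le_rfl, hu.1.le⟩ ⟨hu.1.le, le_rfl⟩ hu.1.le, htop, hbot]
  refine hM ⟨_, feasible_map hTm hT01 ?_ hbal ?_, ?_⟩
  · filter_upwards [M.ae_prior_mem_Icc] with θ hθ using (hge θ hθ).2
  · filter_upwards [M.ae_prior_mem_Icc, M.ae_prior_ne M.θs] with θ hθ hne hnot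
    rw [himg] at hnot
    refine hT3 ⟨?_, hθ.2⟩
    by_contra! hle
    rcases lt_or_gt_of_ne hne with h | h
    · exact hnot (Or.inl ⟨hθ.1, h⟩)
    · exact hnot (Or.inr ⟨h, hle⟩)
  · have hpair : AEMeasurable (fun θ => (θ, T θ)) M.prior := aemeasurable_id.prodMk hTm
    have := Measure.isProbabilityMeasure_map hpair
    rw [prob_compl_eq_zero_iff (measurableSet_le measurable_const measurable_snd) |>.symm]
    refine (ae_map_iff hpair (measurableSet_le measurable_const measurable_snd)).2 ?_
    filter_upwards [M.ae_prior_mem_Icc] with θ hθ using (hge θ hθ).1.1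

/-! ### Existence of the pools -/

lemma continuousOn_of_antitoneOn_of_surjOn {h : ℝ → ℝ} {a b p q : ℝ}
    (hanti : AntitoneOn h (Icc a b)) (hmaps : MapsTo h (Icc a b) (Icc p q))
    (hsurj : SurjOn h (Icc a b) (Icc p q)) : ContinuousOn h (Icc a b) := by
  have hneg : ∀ x : Icc a b, -h x ∈ Icc (-q) (-p) := fun x =>
    ⟨neg_le_neg (hmaps x.2).2, neg_le_neg (hmaps x.2).1⟩
  have hcont : Continuous fun x : Icc a b => (⟨-h x, hneg x⟩ : Icc (-q) (-p)) := by
    refine Monotone.continuous_of_surjective (fun x y hxy => ?_) ?_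
    · exact neg_le_neg (hanti x.2 y.2 hxy)
    · rintro ⟨y, hy⟩
      obtain ⟨x, hx, hxy⟩ := hsurj (show -y ∈ Icc p q from
        ⟨by linarith [hy.2], by linarith [hy.1]⟩)
      exact ⟨⟨x, hx⟩, Subtype.ext (by simp [hxy])⟩
  rw [continuousOn_iff_continuous_domRestrict]
  refine (continuous_subtype_val.comp hcont).neg.congr fun x => ?_
  simp [domRestrict]

lemma Icc_mem_nhdsWithin_Icc {a b s t : ℝ} (hs : s < t) : Icc s b ∈ 𝓝[Icc a b] t := by
  refine mem_nhdsWithin.2 ⟨Ioi s, isOpen_Ioi, hs, fun r hr => ⟨hr.1.le, hr.2.2⟩⟩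

/-- A solution of the clamped equation with values in `[0, β]`, where the clamp is inactive, is a
pooling. -/
lemma isPooling_of_hasDerivWithinAt {A : ℝ → ℝ} {β u : ℝ} (hu : u ∈ Ioc M.θs 1) (hβ : β ≤ M.θs)
    (hcont : ContinuousOn A (Icc M.θs u)) (hA : MapsTo A (Icc M.θs u) (Icc 0 β))
    (hd : ∀ t ∈ Ioc M.θs u, HasDerivWithinAt A (M.clampedSlope β t (A t)) (Icc M.θs u) t) :
    M.IsPooling A u := by
  refine ⟨hu, hcont, fun t ht => ⟨(hA ht).1, (hA ht).2.trans hβ⟩, fun t ht => ?_⟩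
  have h := hA ⟨ht.1.le, ht.2⟩
  have := hd t ht
  rwa [clampedSlope, min_eq_left h.2, max_eq_right h.1] at this

lemma IsPooling.isClampedSolution {A : ℝ → ℝ} (hA : M.IsPooling A 1) {s : ℝ} (hs : M.θs < s) :
    M.IsClampedSolution M.θs s A := by
  intro t ht
  have h := hA.mapsTo ⟨hs.le.trans ht.1, ht.2⟩
  rw [clampedSlope, min_eq_left h.2, max_eq_right h.1]
  exact (hA.hasDeriv t ⟨hs.trans_le ht.1, ht.2⟩).mono (Icc_subset_Icc_left hs.le)

/-- Poolings do not cross. The field is singular at `t = a = θ*`, so uniqueness holds on each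
`[s, 1]` with `s > θ*` only; continuity at `θ*` then forbids different starting points. -/
lemma IsPooling.lt_of_lt {A B : ℝ → ℝ} (hA : M.IsPooling A 1) (hB : M.IsPooling B 1)
    (h : A M.θs < B M.θs) {t : ℝ} (ht : t ∈ Icc M.θs 1) : A t < B t := by
  by_contra! hle
  have hcont : ∀ r ∈ Icc M.θs 1, ContinuousOn (fun r => A r - B r) (Icc M.θs r) := fun r hr =>
    (hA.continuousOn.sub hB.continuousOn).mono (Icc_subset_Icc_right hr.2)
  obtain ⟨r, hr, hr0⟩ := intermediate_value_Icc ht.1 (hcont t ht)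
    (show (0 : ℝ) ∈ Icc _ _ from ⟨by linarith, by linarith⟩)
  have hr1 : r ∈ Icc M.θs 1 := ⟨hr.1, hr.2.trans ht.2⟩
  obtain ⟨q, hq, hq0⟩ := intermediate_value_Icc hr.1 (hcont r hr1)
    (show (A M.θs - B M.θs) / 2 ∈ Icc _ _ from ⟨by linarith, by simp only [hr0]; linarith⟩)
  simp only at hr0 hq0
  have hqθ : M.θs < q := lt_of_le_of_ne hq.1 fun e => by rw [← e] at hq0; linarith
  have hq1 : q ∈ Ioc M.θs 1 := ⟨hqθ, hq.2.trans hr1.2⟩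
  have := (hA.isClampedSolution hqθ).eqOn (hB.isClampedSolution hqθ) M.θs_pos.le
    ⟨hqθ.le, hq1.2⟩ (M.θs_lt_c hq1) ⟨hq.2, hr1.2⟩ (by linarith) ⟨le_rfl, hq1.2⟩
  rw [this] at hq0
  linarith

/-- The limit of the solutions that start at `b < θ*`, as `b` increases to `θ*`, solves the singular
problem that starts at `θ*`: a supremum of continuous functions bounded by `θ*` is continuous at
`θ*`. -/
lemma exists_singular_solution (M : Market) :
    ∃ A : ℝ → ℝ, A M.θs = M.θs ∧ ContinuousOn A (Icc M.θs 1) ∧ AntitoneOn A (Icc M.θs 1) ∧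
      (∀ t ∈ Ioc M.θs 1, HasDerivWithinAt A (M.clampedSlope M.θs t (A t)) (Icc M.θs 1) t) ∧
      ∀ a < A 1, ∃ β ∈ Ioo 0 M.θs, ∃ B, B M.θs = β ∧ M.IsClampedSolution β M.θs B ∧ a < B 1 := by
  have hθ0 := M.θs_pos
  have hθ1 := M.θs_lt_one
  have hmem : M.θs ∈ Icc M.θs 1 := ⟨le_rfl, hθ1.le⟩
  set b : ℕ → ℝ := fun n => M.θs - M.θs / ((n : ℝ) + 2) with hb
  have hb_mem : ∀ n, b n ∈ Ioo 0 M.θs := fun n => by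
    have h2 : (1 : ℝ) < (n : ℝ) + 2 := by linarith [n.cast_nonneg (α := ℝ)]
    have h3 : M.θs / ((n : ℝ) + 2) < M.θs := div_lt_self hθ0 h2
    have h4 : 0 < M.θs / ((n : ℝ) + 2) := by positivity
    exact ⟨by simp only [hb]; linarith, by simp only [hb]; linarith⟩
  have hb_lt : ∀ n, b n < b (n + 1) := fun n => by
    simp only [hb]
    push_cast
    gcongr
    linarith
  have hb_lim : Filter.Tendsto b Filter.atTop (𝓝 M.θs) := by
    have h1 : Filter.Tendsto (fun n : ℕ => (n : ℝ) + 2) Filter.atTop Filter.atTop :=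
      Filter.tendsto_atTop_add_const_right _ _ tendsto_natCast_atTop_atTop
    simpa [hb] using (tendsto_const_nhds (x := M.θs)).sub (h1.const_div_atTop M.θs)
  have hbc : ∀ n, b n < M.c M.θs := fun n => by rw [M.c_θs]; exact (hb_mem n).2
  choose An hAn0 hAn using fun n =>
    exists_isClampedSolution (hb_mem n).1.le hmem (hbc n) hmem (b n)
  have hAn_anti : ∀ n, AntitoneOn (An n) (Icc M.θs 1) := fun n =>
    (hAn n).antitoneOn (hb_mem n).1.le (hb_mem n).2.le le_rfl
  have hAn_le : ∀ n, ∀ t ∈ Icc M.θs 1, An n t ≤ b n := fun n t ht =>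
    (hAn_anti n hmem ht ht.1).trans (hAn0 n).le
  have hAn_mono : ∀ t ∈ Icc M.θs 1, Monotone fun n => An n t := fun t ht =>
    monotone_nat_of_le_succ fun n =>
      (((hAn n).of_le (hb_lt n).le (hAn_le n)).lt_of_lt (hAn (n + 1)) (hb_mem _).1.le hmem
        (hbc _) hmem (by rw [hAn0, hAn0]; exact hb_lt n) ht).le
  have hbdd : ∀ t ∈ Icc M.θs 1, BddAbove (range fun n => An n t) := fun t ht =>
    ⟨M.θs, by rintro _ ⟨n, rfl⟩; exact (hAn_le n t ht).trans (hb_mem n).2.le⟩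
  set A : ℝ → ℝ := fun t => ⨆ n, An n t
  have hlim : ∀ t ∈ Icc M.θs 1, Filter.Tendsto (fun n => An n t) Filter.atTop (𝓝 (A t)) :=
    fun t ht => tendsto_atTop_ciSup (hAn_mono t ht) (hbdd t ht)
  have hA_le : ∀ t ∈ Icc M.θs 1, A t ≤ M.θs := fun t ht =>
    ciSup_le fun n => (hAn_le n t ht).trans (hb_mem n).2.le
  have hAθ : A M.θs = M.θs := by
    refine tendsto_nhds_unique (hlim _ hmem) ?_
    simpa only [hAn0] using hb_lim
  have hsol : ∀ s ∈ Ioc M.θs 1, M.IsClampedSolution M.θs s A := fun s hs =>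
    IsClampedSolution.of_tendsto (An := An)
      (fun n => ((hAn n).of_le (hb_mem n).2.le (hAn_le n)).mono_left hs.1.le) hθ0.le
      ⟨hs.1.le, hs.2⟩ (M.θs_lt_c hs) fun t ht => hlim t ⟨hs.1.le.trans ht.1, ht.2⟩
  have hderiv : ∀ t ∈ Ioc M.θs 1,
      HasDerivWithinAt A (M.clampedSlope M.θs t (A t)) (Icc M.θs 1) t := fun t ht => by
    have h1 : M.θs < (M.θs + t) / 2 := by linarith [ht.1]
    have h2 : (M.θs + t) / 2 < t := by linarith [ht.1]
    exact (hsol _ ⟨h1, h2.le.trans ht.2⟩ t ⟨h2.le, ht.2⟩).mono_of_mem_nhdsWithin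
      (Icc_mem_nhdsWithin_Icc h2)
  refine ⟨A, hAθ, fun t ht => ?_, fun s hs t ht hst => ?_, hderiv, fun a ha => ?_⟩
  · rcases eq_or_lt_of_le ht.1 with rfl | h
    · refine tendsto_order.2 ⟨fun a ha => ?_, fun a ha => ?_⟩
      · rw [hAθ] at ha
        obtain ⟨n, hn⟩ := (hb_lim.eventually (lt_mem_nhds ha)).exists
        have := ((hAn n).continuousOn _ hmem).eventually (lt_mem_nhds ((hAn0 n).symm ▸ hn))
        filter_upwards [this, self_mem_nhdsWithin] with t h1 ht
        exact h1.trans_le (le_ciSup (hbdd t ht) n)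
      · filter_upwards [self_mem_nhdsWithin] with t ht
        exact (hA_le t ht).trans_lt (hAθ ▸ ha)
    · exact (hderiv t ⟨h, ht.2⟩).continuousWithinAt
  · exact ciSup_mono (hbdd s hs) fun n => hAn_anti n hs ht hst
  · obtain ⟨n, hn⟩ := exists_lt_of_lt_ciSup ha
    exact ⟨b n, hb_mem n, An n, hAn0 n, hAn n, hn⟩

/-- Without full trade, the singular solution stays positive up to `t = 1`, and there is a pooling
that pairs the types `0` and `1`. -/
lemma NoFullTrade.exists_isPooling (hM : M.NoFullTrade) :
    (∃ A, M.IsPooling A 1 ∧ A 1 = 0) ∧ ∃ A, M.IsPooling A 1 ∧ A M.θs = M.θs := by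
  have hθ0 := M.θs_pos
  have hθ1 := M.θs_lt_one
  have hmem : M.θs ∈ Icc M.θs 1 := ⟨le_rfl, hθ1.le⟩
  have hmem1 : (1 : ℝ) ∈ Icc M.θs 1 := ⟨hθ1.le, le_rfl⟩
  obtain ⟨A, hAθ, hcont, hanti, hd, hex⟩ := M.exists_singular_solution
  have hpool : ∀ u ∈ Ioc M.θs 1, 0 ≤ A u → M.IsPooling A u := by
    intro u hu h0
    have hsub : Icc M.θs u ⊆ Icc M.θs 1 := Icc_subset_Icc_right hu.2
    have hu' : u ∈ Icc M.θs 1 := ⟨hu.1.le, hu.2⟩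
    refine isPooling_of_hasDerivWithinAt hu le_rfl (hcont.mono hsub) (fun t ht => ?_) fun t ht =>
      (hd t ⟨ht.1, ht.2.trans hu.2⟩).mono hsub
    exact ⟨h0.trans (hanti (hsub ht) hu' ht.2),
      (hanti hmem (hsub ht) ht.1).trans hAθ.le⟩
  have hA1 : 0 < A 1 := by
    by_contra! hle
    obtain ⟨u, hu, hu0⟩ := intermediate_value_Icc' hθ1.le hcont
      (show (0 : ℝ) ∈ Icc _ _ from ⟨hle, by rw [hAθ]; exact hθ0.le⟩)
    have hu' : u ∈ Ioc M.θs 1 :=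
      ⟨lt_of_le_of_ne hu.1 fun e => by rw [← e, hAθ] at hu0; exact hθ0.ne' hu0, hu.2⟩
    exact hM.false_of_isPooling (hpool u hu' hu0.ge) hAθ hu0
  refine ⟨?_, A, hpool 1 ⟨hθ1, le_rfl⟩ hA1.le, hAθ⟩
  obtain ⟨β, hβ, B, hBθ, hB, hB1⟩ := hex 0 hA1
  have hβc : β < M.c M.θs := by rw [M.c_θs]; exact hβ.2
  obtain ⟨C, hC1, hC⟩ := exists_isClampedSolution hβ.1.le hmem hβc hmem1 0
  have hCanti := hC.antitoneOn hβ.1.le hβ.2.le le_rfl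
  -- `C` ends below `B`, so it starts below `B(θ*) = β` and the clamp is never active.
  have hCθ := hC.lt_of_lt hB hβ.1.le hmem hβc hmem1 (hC1 ▸ hB1) hmem
  refine ⟨C, isPooling_of_hasDerivWithinAt ⟨hθ1, le_rfl⟩ hβ.2.le hC.continuousOn (fun t ht => ?_)
    fun t ht => hC t ⟨ht.1.le, ht.2⟩, hC1⟩
  exact ⟨hC1.ge.trans (hCanti ht hmem1 ht.2), (hCanti hmem ht ht.1).trans (hBθ ▸ hCθ.le)⟩

/-! ### Matching functions and pools -/

namespace IsMatching

variable {g : ℝ → ℝ} {lo hi : ℝ}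

lemma inv_mem (hg : M.IsMatching g lo hi) {x : ℝ} (hx : x ∈ Icc M.θs (M.c 1)) :
    inv g lo hi x ∈ Icc lo hi := Function.invFunOn_mem (hg.bijOn.surjOn hx)

lemma apply_inv (hg : M.IsMatching g lo hi) {x : ℝ} (hx : x ∈ Icc M.θs (M.c 1)) :
    g (inv g lo hi x) = x := Function.invFunOn_eq (hg.bijOn.surjOn hx)

lemma inv_apply (hg : M.IsMatching g lo hi) {θ : ℝ} (hθ : θ ∈ Icc lo hi) :
    inv g lo hi (g θ) = θ :=
  hg.bijOn.injOn (hg.inv_mem (hg.bijOn.mapsTo hθ)) hθ (hg.apply_inv (hg.bijOn.mapsTo hθ))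

lemma strictAntiOn_inv (hg : M.IsMatching g lo hi) :
    StrictAntiOn (inv g lo hi) (Icc M.θs (M.c 1)) := by
  intro x hx y hy hxy
  by_contra! hle
  have := hg.strictAnti.antitoneOn (hg.inv_mem hx) (hg.inv_mem hy) hle
  rw [hg.apply_inv hx, hg.apply_inv hy] at this
  exact absurd hxy (not_lt.2 this)

lemma lo_le_hi (hg : M.IsMatching g lo hi) : lo ≤ hi :=
  have h := hg.inv_mem ⟨le_rfl, M.θs_lt_c_one.le⟩
  h.1.trans h.2

lemma inv_c_one (hg : M.IsMatching g lo hi) : inv g lo hi (M.c 1) = lo := by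
  have hmem1 : M.c 1 ∈ Icc M.θs (M.c 1) := ⟨M.θs_lt_c_one.le, le_rfl⟩
  have h1 : lo ∈ Icc lo hi := ⟨le_rfl, hg.lo_le_hi⟩
  have h2 := hg.strictAntiOn_inv.antitoneOn (hg.bijOn.mapsTo h1) hmem1 (hg.bijOn.mapsTo h1).2
  rw [hg.inv_apply h1] at h2
  exact le_antisymm h2 (hg.inv_mem hmem1).1

lemma inv_θs (hg : M.IsMatching g lo hi) : inv g lo hi M.θs = hi := by
  have hmem : M.θs ∈ Icc M.θs (M.c 1) := ⟨le_rfl, M.θs_lt_c_one.le⟩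
  have h1 : hi ∈ Icc lo hi := ⟨hg.lo_le_hi, le_rfl⟩
  have h2 := hg.strictAntiOn_inv.antitoneOn hmem (hg.bijOn.mapsTo h1) (hg.bijOn.mapsTo h1).1
  rw [hg.inv_apply h1] at h2
  exact le_antisymm (hg.inv_mem hmem).2 h2

lemma lo_lt_hi (hg : M.IsMatching g lo hi) : lo < hi := by
  have := hg.strictAntiOn_inv ⟨le_rfl, M.θs_lt_c_one.le⟩ ⟨M.θs_lt_c_one.le, le_rfl⟩ M.θs_lt_c_one
  rwa [hg.inv_c_one, hg.inv_θs] at this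

/-- A matching function `g` gives the pooling `A(t) = g⁻¹(c(t))`. -/
lemma isPooling (hg : M.IsMatching g lo hi) :
    M.IsPooling (fun t => inv g lo hi (M.c t)) 1 := by
  have hθ1 := M.θs_lt_one
  have hcbij := M.c_bijOn
  have hmaps : MapsTo (fun t => inv g lo hi (M.c t)) (Icc M.θs 1) (Icc lo hi) := fun t ht =>
    hg.inv_mem (hcbij.mapsTo ht)
  have hsub : Icc lo hi ⊆ Icc 0 M.θs := Icc_subset_Icc hg.lo_nonneg hg.hi_le
  refine ⟨⟨hθ1, le_rfl⟩, continuousOn_of_antitoneOn_of_surjOn (p := lo) (q := hi) ?_ hmaps ?_,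
    fun t ht => hsub (hmaps ht), fun t ht => ?_⟩
  · intro s hs t ht hst
    exact hg.strictAntiOn_inv.antitoneOn (hcbij.mapsTo hs) (hcbij.mapsTo ht)
      (M.c_strictMonoOn_top.monotoneOn hs ht hst)
  · intro θ hθ
    obtain ⟨t, ht, htc⟩ := hcbij.surjOn (hg.bijOn.mapsTo hθ)
    exact ⟨t, ht, by simp only [htc, hg.inv_apply hθ]⟩
  · obtain ⟨A', hA', hode⟩ := hg.ode t ht
    have ht' : t ∈ Icc M.θs 1 := ⟨ht.1.le, ht.2⟩
    have ha := hsub (hmaps ht')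
    have hct := M.θs_lt_c ht
    have hfa := M.f_pos _ ⟨ha.1, ha.2.trans hθ1.le⟩
    have hc0 : M.c t ≠ 0 := (M.θs_pos.trans hct).ne'
    set a := inv g lo hi (M.c t) with hadef
    -- If the total weight vanished, the quotients in the equation would be `0`, but `c(t) ≠ 0`.
    have hden : -M.f a * A' + M.f t ≠ 0 := by
      intro h0
      rw [h0] at hode
      simp only [div_zero, mul_zero, add_zero] at hode
      exact hc0 hode
    have ha2 : a ≤ M.θs := ha.2
    have hca : M.c t - a ≠ 0 := by linarith
    have : A' = M.poolingSlope t a := by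
      unfold poolingSlope
      rw [eq_div_iff (mul_ne_zero hca hfa.ne')]
      rw [← mul_div_assoc, ← mul_div_assoc, ← add_div, eq_div_iff hden] at hode
      linear_combination -hode
    rw [← this]
    exact hA'

end IsMatching

/-- A pooling `A` is the inverse of a matching function after the change of variable `x = c(t)`. -/
lemma IsPooling.isMatching {A : ℝ → ℝ} (hA : M.IsPooling A 1) :
    M.IsMatching (M.c ∘ Function.invFunOn A (Icc M.θs 1)) (A 1) (A M.θs) := by
  have hθ1 := M.θs_lt_one
  have hmem : M.θs ∈ Icc M.θs 1 := ⟨le_rfl, hθ1.le⟩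
  have hmem1 : (1 : ℝ) ∈ Icc M.θs 1 := ⟨hθ1.le, le_rfl⟩
  have hbij := hA.bijOn
  set τ := Function.invFunOn A (Icc M.θs 1) with hτ
  have hinv : ∀ θ ∈ Icc (A 1) (A M.θs), τ θ ∈ Icc M.θs 1 ∧ A (τ θ) = θ :=
    fun θ hθ => ⟨Function.invFunOn_mem (hbij.surjOn hθ), Function.invFunOn_eq (hbij.surjOn hθ)⟩
  have hleft : ∀ t ∈ Icc M.θs 1, τ (A t) = t := fun t ht =>
    hbij.injOn (hinv _ (hbij.mapsTo ht)).1 ht (hinv _ (hbij.mapsTo ht)).2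
  have hτanti : StrictAntiOn τ (Icc (A 1) (A M.θs)) := by
    intro x hx y hy hxy
    by_contra! hle
    have := hA.strictAntiOn.antitoneOn (hinv x hx).1 (hinv y hy).1 hle
    rw [(hinv x hx).2, (hinv y hy).2] at this
    exact absurd hxy (not_lt.2 this)
  have hτbij : BijOn τ (Icc (A 1) (A M.θs)) (Icc M.θs 1) :=
    ⟨fun θ hθ => (hinv θ hθ).1, hτanti.injOn, fun t ht => ⟨A t, hbij.mapsTo ht, hleft t ht⟩⟩
  have hτcont : ContinuousOn τ (Icc (A 1) (A M.θs)) :=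
    continuousOn_of_antitoneOn_of_surjOn hτanti.antitoneOn hτbij.mapsTo hτbij.surjOn
  have hgbij : BijOn (M.c ∘ τ) (Icc (A 1) (A M.θs)) (Icc M.θs (M.c 1)) := M.c_bijOn.comp hτbij
  have hgA : ∀ t ∈ Icc M.θs 1, inv (M.c ∘ τ) (A 1) (A M.θs) (M.c t) = A t := by
    intro t ht
    have hx : M.c t ∈ (M.c ∘ τ) '' Icc (A 1) (A M.θs) := hgbij.surjOn (M.c_bijOn.mapsTo ht)
    refine hgbij.injOn (Function.invFunOn_mem hx) (hbij.mapsTo ht) ?_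
    exact (Function.invFunOn_eq hx).trans (by rw [Function.comp_apply, hleft t ht])
  refine ⟨(hA.mapsTo hmem1).1, (hA.mapsTo hmem).2, fun x hx y hy hxy => ?_, hgbij,
    fun θ hθ => ?_, fun t ht => ?_⟩
  · exact M.c_strictMonoOn_top (hτbij.mapsTo hy) (hτbij.mapsTo hx) (hτanti hx hy hxy)
  · have hθ' : θ ∈ Icc (A 1) (A M.θs) := ⟨hθ.1, hθ.2.le⟩
    obtain ⟨h1, h2⟩ := hinv θ hθ'
    have h3 : M.θs < τ θ := lt_of_le_of_ne h1.1 fun e => by rw [← e] at h2; exact hθ.2.ne h2.symm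
    have hne : M.poolingSlope (τ θ) (A (τ θ)) ≠ 0 :=
      (M.poolingSlope_neg ⟨h3, h1.2⟩ (hA.mapsTo h1)).ne
    have he : ((ContinuousLinearEquiv.unitsEquivAut ℝ (Units.mk0 _ hne) : ℝ ≃L[ℝ] ℝ) : ℝ →L[ℝ] ℝ) =
        ContinuousLinearMap.toSpanSingleton ℝ (M.poolingSlope (τ θ) (A (τ θ))) := by
      ext
      simp
    have hAd := (hA.hasDeriv (τ θ) ⟨h3, h1.2⟩).hasFDerivWithinAt
    have hτd : DifferentiableWithinAt ℝ τ (Icc (A 1) (A M.θs)) θ := by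
      have ht : Filter.Tendsto τ (𝓝[Icc (A 1) (A M.θs)] θ) (𝓝[Icc M.θs 1] (τ θ)) :=
        (hτcont θ hθ').tendsto_nhdsWithin hτbij.mapsTo
      exact (HasFDerivWithinAt.of_local_left_inverse
        (f' := ContinuousLinearEquiv.unitsEquivAut ℝ (Units.mk0 _ hne)) ht
        (by rw [he]; exact hAd) hθ'
        (Filter.eventually_of_mem self_mem_nhdsWithin
          fun x hx => (hinv x hx).2)).differentiableWithinAt
    have hcd : DifferentiableWithinAt ℝ M.c (Icc M.θs 1) (τ θ) :=
      ((M.c_contDiff.differentiableOn one_ne_zero) _ (M.mem_Icc_zero_one h1)).mono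
        fun _ => M.mem_Icc_zero_one
    exact (hcd.comp θ hτd hτbij.mapsTo).mono Ico_subset_Icc_self
  · have ht' : t ∈ Icc M.θs 1 := ⟨ht.1.le, ht.2⟩
    refine ⟨M.poolingSlope t (A t), (hA.hasDeriv t ht).congr hgA (hgA t ht'), ?_⟩
    rw [hgA t ht']
    have ha := hA.mapsTo ht'
    have hfa := M.f_pos _ ⟨ha.1, ha.2.trans hθ1.le⟩
    have hft := M.f_pos _ (M.mem_Icc_zero_one ht')
    have hct := M.θs_lt_c ht
    have hctt := M.c_above t ht
    have hca : M.c t - A t ≠ 0 := by linarith [ha.2]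
    have hv : -M.f (A t) * M.poolingSlope t (A t) = (t - M.c t) * M.f t / (M.c t - A t) := by
      unfold poolingSlope
      field_simp
    have hden : (t - M.c t) * M.f t / (M.c t - A t) + M.f t
        = (t - A t) * M.f t / (M.c t - A t) := by
      field_simp
      ring
    have hta : t - A t ≠ 0 := by linarith [ha.2, ht.1]
    rw [hv, hden]
    field_simp
    ring

lemma NoFullTrade.exists_isMatchingPair (hM : M.NoFullTrade) :
    ∃ (g₁ g₂ : ℝ → ℝ) (θbar θlow : ℝ), M.IsMatchingPair g₁ g₂ θbar θlow := by
  obtain ⟨⟨A, hA, hA1⟩, B, hB, hBθ⟩ := hM.exists_isPooling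
  refine ⟨M.c ∘ Function.invFunOn A (Icc M.θs 1), M.c ∘ Function.invFunOn B (Icc M.θs 1),
    A M.θs, B 1, ?_, ?_⟩
  · have := hA.isMatching
    rwa [hA1] at this
  · have := hB.isMatching
    rwa [hBθ] at this

/-- The order of the cutoffs. If the first matching reached `θ*`, its pools would exhaust all
inefficient types; hence it starts below the second one and stays below. -/
lemma NoFullTrade.cutoffs (hM : M.NoFullTrade) {g₁ g₂ : ℝ → ℝ} {θbar θlow : ℝ}
    (hg : M.IsMatchingPair g₁ g₂ θbar θlow) :
    θbar < M.θs ∧ ∀ x ∈ Icc M.θs (M.c 1), inv g₁ 0 θbar x < inv g₂ θlow M.θs x := by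
  obtain ⟨h₁, h₂⟩ := hg
  have hbar : θbar < M.θs := by
    refine lt_of_le_of_ne h₁.hi_le fun e => ?_
    refine hM.false_of_isPooling h₁.isPooling ?_ h₁.inv_c_one
    rw [M.c_θs, h₁.inv_θs, e]
  refine ⟨hbar, fun x hx => ?_⟩
  obtain ⟨t, ht, rfl⟩ := M.c_bijOn.surjOn hx
  refine h₁.isPooling.lt_of_lt h₂.isPooling ?_ ht
  rwa [M.c_θs, h₁.inv_θs, h₂.inv_θs]

/-! ### Weak duality -/

namespace Feasible

variable {π : Measure (ℝ × ℝ)}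

lemma map_fst (hπ : M.Feasible π) : π.map Prod.fst = M.prior := by
  refine Measure.ext fun A hA => ?_
  rw [Measure.map_apply measurable_fst hA, ← hπ.bayes A hA]
  congr 1
  ext z
  simp

lemma ae_fst (hπ : M.Feasible π) {P : ℝ → Prop} (h : ∀ᵐ θ ∂M.prior, P θ) : ∀ᵐ z ∂π, P z.1 := by
  rw [← hπ.map_fst] at h
  exact ae_of_ae_map measurable_fst.aemeasurable h

lemma ae_auxCost_le (hπ : M.Feasible π) : ∀ᵐ z ∂π, M.auxCost z.1 ≤ z.2 := by
  have := hπ.priceMean univ MeasurableSet.univ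
  refine measure_mono_null (fun z hz => ?_) this
  exact ⟨mem_univ _, not_le.1 hz⟩

lemma integrable_sub (hπ : M.Feasible π) : Integrable (fun z : ℝ × ℝ => z.2 - z.1) π := by
  have := hπ.prob
  refine Integrable.of_bound (measurable_snd.sub measurable_fst).aestronglyMeasurable 1 ?_
  filter_upwards [hπ.support] with z hz
  rw [Real.norm_eq_abs, abs_le]
  exact ⟨by linarith [hz.1.2, hz.2.1], by linarith [hz.1.1, hz.2.2]⟩

/-- Almost no type has the posterior mean `θ*`: more efficient types cannot be assigned `θ*`, so by
the martingale condition only the type `θ*` itself can. -/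
lemma ae_snd_ne (hπ : M.Feasible π) : ∀ᵐ z ∂π, z.2 ≠ M.θs := by
  have hS : MeasurableSet (univ ×ˢ {M.θs} : Set (ℝ × ℝ)) :=
    MeasurableSet.univ.prod (measurableSet_singleton _)
  have hnn : 0 ≤ᵐ[π.restrict (univ ×ˢ {M.θs})] fun z : ℝ × ℝ => z.2 - z.1 := by
    refine (ae_restrict_iff' hS).2 ?_
    filter_upwards [hπ.ae_auxCost_le, hπ.support] with z h1 h2 h3
    have h3 : z.2 = M.θs := h3.2
    simp only [Pi.zero_apply, sub_nonneg]
    rw [h3] at h1 ⊢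
    by_contra! hlt
    rcases min_le_iff.1 h1 with h | h
    · exact absurd h (not_le.2 hlt)
    · exact absurd h (not_le.2 (M.θs_lt_c ⟨hlt, h2.1.2⟩))
  have h0 := (setIntegral_eq_zero_iff_of_nonneg_ae hnn hπ.integrable_sub.integrableOn).1
    (hπ.martingale _ (measurableSet_singleton _))
  filter_upwards [(ae_restrict_iff' hS).1 h0, hπ.ae_fst (M.ae_prior_ne M.θs)] with z h1 h2 h3
  have := h1 ⟨mem_univ _, h3⟩
  simp only [Pi.zero_apply, sub_eq_zero] at this
  exact h2 (this ▸ h3)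

lemma integral_mul_sub (hπ : M.Feasible π) {q : ℝ → ℝ} (hq : Measurable q) {K : ℝ}
    (hK : ∀ x, |q x| ≤ K) : ∫ z, q z.2 * (z.2 - z.1) ∂π = 0 := by
  have := hπ.prob
  set m : MeasurableSpace (ℝ × ℝ) := MeasurableSpace.comap Prod.snd inferInstance with hm
  have hle : m ≤ Prod.instMeasurableSpace := measurable_snd.comap_le
  have hcond : (0 : ℝ × ℝ → ℝ) =ᵐ[π] π[fun z : ℝ × ℝ => z.2 - z.1|m] := by
    refine ae_eq_condExp_of_forall_setIntegral_eq hle hπ.integrable_sub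
      (fun _ _ _ => integrableOn_zero) (fun s hs _ => ?_)
      (stronglyMeasurable_zero.aestronglyMeasurable)
    obtain ⟨B, hB, rfl⟩ := hs
    have := hπ.martingale B hB
    rw [univ_prod] at this
    simp [this]
  have hqm : StronglyMeasurable[m] fun z : ℝ × ℝ => q z.2 :=
    (hq.comp (comap_measurable Prod.snd)).stronglyMeasurable
  have hmul := condExp_stronglyMeasurable_mul_of_bound hle hqm hπ.integrable_sub K
    (Filter.Eventually.of_forall fun z => hK z.2)
  have : ∫ z, ((fun z : ℝ × ℝ => q z.2) * fun z : ℝ × ℝ => z.2 - z.1) z ∂π = 0 := by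
    rw [← integral_condExp hle]
    refine integral_eq_zero_of_ae ?_
    filter_upwards [hmul, hcond] with z h1 h2
    rw [h1, Pi.mul_apply, ← h2, Pi.zero_apply, mul_zero]
  exact this

lemma integrable_indicator (hπ : M.Feasible π) {α : ℝ → ℝ} (hα : AEMeasurable α M.prior) {K : ℝ}
    (hK : ∀ θ ∈ Icc (0 : ℝ) 1, |α θ| ≤ K) :
    Integrable ({z : ℝ × ℝ | M.θs ≤ z.2}.indicator fun z => α z.1) π := by
  have := hπ.prob
  refine Integrable.indicator ?_ (measurableSet_le measurable_const measurable_snd)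
  have hm : AEMeasurable (fun z : ℝ × ℝ => α z.1) π :=
    (hπ.map_fst ▸ hα).comp_measurable measurable_fst
  refine Integrable.of_bound hm.aestronglyMeasurable K ?_
  filter_upwards [hπ.ae_fst M.ae_prior_mem_Icc] with z hz using hK _ hz

/-- A measure carried by the graph of `T` is determined by its first marginal. -/
lemma eq_map (hπ : M.Feasible π) {T : ℝ → ℝ} (hT : AEMeasurable T M.prior)
    (h : ∀ᵐ z ∂π, z.2 = T z.1) : π = M.prior.map fun θ => (θ, T θ) := by
  rw [← hπ.map_fst] at hT ⊢
  have hpair : AEMeasurable (fun θ => (θ, T θ)) (π.map Prod.fst) := aemeasurable_id.prodMk hT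
  rw [AEMeasurable.map_map_of_aemeasurable hpair measurable_fst.aemeasurable]
  conv_lhs => rw [← Measure.map_id (μ := π)]
  refine Measure.map_congr ?_
  filter_upwards [h] with z hz
  exact Prod.ext rfl hz

end Feasible

/-- The posterior means outside a shrinking right neighbourhood of `θ*`. The multiplier may be
unbounded there. -/
def awayFrom (M : Market) (n : ℕ) : Set ℝ := (Ioo M.θs (M.θs + 1 / ((n : ℝ) + 1)))ᶜ

lemma measurableSet_awayFrom (n : ℕ) : MeasurableSet (M.awayFrom n) := measurableSet_Ioo.compl

lemma awayFrom_mono : Monotone M.awayFrom := by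
  intro m n h
  refine compl_subset_compl.2 (Ioo_subset_Ioo_right ?_)
  gcongr

lemma iUnion_awayFrom : ⋃ n, M.awayFrom n = univ := by
  refine eq_univ_of_forall fun x => mem_iUnion.2 ?_
  rcases le_or_gt x M.θs with h | h
  · exact ⟨0, fun hx => absurd h (not_le.2 hx.1)⟩
  · obtain ⟨n, hn⟩ := exists_nat_one_div_lt (sub_pos.2 h)
    exact ⟨n, fun hx => by linarith [hx.2]⟩

lemma iUnion_univ_prod_awayFrom : ⋃ n, (univ : Set ℝ) ×ˢ M.awayFrom n = univ := by
  rw [← prod_iUnion, iUnion_awayFrom, univ_prod_univ]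

/-- `p` is a multiplier of the martingale condition that supports the assignment `T`: net of the
price `p(x)(x - θ)`, almost every type `θ` strictly prefers `T θ` to any other posterior mean that
it may be assigned. It may explode at `θ*` from the right, as long as the prices paid by the
inefficient types stay bounded. -/
structure Supports (M : Market) (α : ℝ → ℝ) (p T : ℝ → ℝ) : Prop where
  measurable : Measurable p
  bounded : ∀ n, ∃ K, ∀ x ∈ M.awayFrom n, |p x| ≤ K
  price_bounded : ∃ K, 0 ≤ K ∧ ∀ᵐ θ ∂M.prior, θ ≤ M.θs → |p (T θ) * (T θ - θ)| ≤ K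
  price_nonpos : ∀ᵐ θ ∂M.prior, M.θs < θ → p (T θ) * (T θ - θ) ≤ 0
  gap : ∀ᵐ θ ∂M.prior, ∀ x ∈ Icc (0 : ℝ) 1, M.auxCost θ ≤ x → x ≠ M.θs → x ≠ T θ →
    (Ici M.θs).indicator (fun _ => α θ) x - p x * (x - θ) <
      (Ici M.θs).indicator (fun _ => α θ) (T θ) - p (T θ) * (T θ - θ)

namespace Supports

variable {α p T : ℝ → ℝ}

lemma setIntegral_price (hp : M.Supports α p T) {π : Measure (ℝ × ℝ)} (hπ : M.Feasible π) (n : ℕ) :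
    IntegrableOn (fun z : ℝ × ℝ => p z.2 * (z.2 - z.1)) (univ ×ˢ M.awayFrom n) π ∧
      ∫ z in univ ×ˢ M.awayFrom n, p z.2 * (z.2 - z.1) ∂π = 0 := by
  have := hπ.prob
  obtain ⟨K, hK⟩ := hp.bounded n
  have hS : MeasurableSet (univ ×ˢ M.awayFrom n : Set (ℝ × ℝ)) :=
    MeasurableSet.univ.prod (measurableSet_awayFrom n)
  have hqm : Measurable ((M.awayFrom n).indicator p) :=
    hp.measurable.indicator (measurableSet_awayFrom n)
  have hqK : ∀ x, |(M.awayFrom n).indicator p x| ≤ max K 0 := fun x => by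
    by_cases hx : x ∈ M.awayFrom n
    · rw [indicator_of_mem hx]; exact (hK x hx).trans (le_max_left _ _)
    · rw [indicator_of_notMem hx, abs_zero]; exact le_max_right _ _
  have e : (univ ×ˢ M.awayFrom n).indicator (fun z : ℝ × ℝ => p z.2 * (z.2 - z.1)) =
      fun z => (M.awayFrom n).indicator p z.2 * (z.2 - z.1) := by
    ext z
    by_cases hz : z.2 ∈ M.awayFrom n
    · rw [indicator_of_mem hz, indicator_of_mem (show z ∈ univ ×ˢ M.awayFrom n from ⟨trivial, hz⟩)]
    · rw [indicator_of_notMem hz, zero_mul, indicator_of_notMem fun h => hz h.2]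
  refine ⟨?_, ?_⟩
  · rw [← integrable_indicator_iff hS, e]
    exact hπ.integrable_sub.bdd_mul (c := max K 0) (hqm.comp measurable_snd).aestronglyMeasurable
      (Filter.Eventually.of_forall fun z => hqK z.2)
  · rw [← integral_indicator hS, e]
    exact hπ.integral_mul_sub hqm hqK

/-- The price paid under the supported assignment is integrable with mean zero: it is nonpositive
for the efficient types and bounded for the inefficient ones, and it has mean zero away from `θ*`. -/
lemma integrable_price (hp : M.Supports α p T) (hT : AEMeasurable T M.prior)
    (hν : M.Feasible (M.prior.map fun θ => (θ, T θ))) :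
    Integrable (fun θ => p (T θ) * (T θ - θ)) M.prior ∧
      ∫ θ, p (T θ) * (T θ - θ) ∂M.prior = 0 := by
  have hpair : AEMeasurable (fun θ => (θ, T θ)) M.prior := aemeasurable_id.prodMk hT
  set ν := M.prior.map fun θ => (θ, T θ) with hνdef
  have := hν.prob
  obtain ⟨K, hK0, hK⟩ := hp.price_bounded
  have hm : Measurable fun z : ℝ × ℝ => p z.2 * (z.2 - z.1) :=
    (hp.measurable.comp measurable_snd).mul (measurable_snd.sub measurable_fst)
  have hbound : ∀ᵐ z ∂ν, ‖p z.2 * (z.2 - z.1)‖ ≤ 2 * K - p z.2 * (z.2 - z.1) := by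
    refine (ae_map_iff hpair (measurableSet_le hm.norm (measurable_const.sub hm))).2 ?_
    filter_upwards [hK, hp.price_nonpos] with θ h1 h2
    change |p (T θ) * (T θ - θ)| ≤ 2 * K - p (T θ) * (T θ - θ)
    rcases le_or_gt θ M.θs with h | h
    · linarith [h1 h, (abs_le.1 (h1 h)).2]
    · rw [abs_of_nonpos (h2 h)]; linarith
  have hcover : AECover ν Filter.atTop fun n => (univ ×ˢ M.awayFrom n : Set (ℝ × ℝ)) :=
    { ae_eventually_mem := Filter.Eventually.of_forall fun z => by
        have hz : z.2 ∈ ⋃ n, M.awayFrom n := by rw [iUnion_awayFrom]; trivial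
        obtain ⟨n, hn⟩ := mem_iUnion.1 hz
        filter_upwards [Filter.eventually_ge_atTop n] with k hk
        exact ⟨trivial, awayFrom_mono hk hn⟩
      measurableSet := fun n => MeasurableSet.univ.prod (measurableSet_awayFrom n) }
  have hint : Integrable (fun z : ℝ × ℝ => p z.2 * (z.2 - z.1)) ν := by
    refine hcover.integrable_of_integral_norm_bounded (2 * K)
      (fun n => (hp.setIntegral_price hν n).1) (Filter.Eventually.of_forall fun n => ?_)
    obtain ⟨h1, h2⟩ := hp.setIntegral_price hν n
    have hc : IntegrableOn (fun _ : ℝ × ℝ => 2 * K) (univ ×ˢ M.awayFrom n) ν :=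
      (integrable_const _).integrableOn
    calc ∫ z in univ ×ˢ M.awayFrom n, ‖p z.2 * (z.2 - z.1)‖ ∂ν
        ≤ ∫ z in univ ×ˢ M.awayFrom n, (2 * K - p z.2 * (z.2 - z.1)) ∂ν :=
          integral_mono_ae h1.norm (hc.sub h1) (ae_restrict_of_ae hbound)
      _ = ν.real (univ ×ˢ M.awayFrom n) * (2 * K) := by
          rw [integral_sub hc h1, h2, sub_zero, setIntegral_const, smul_eq_mul]
      _ ≤ 1 * (2 * K) := by
          gcongr
          exact measureReal_le_one
      _ = 2 * K := one_mul _
  have hzero : ∫ z, p z.2 * (z.2 - z.1) ∂ν = 0 := by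
    refine tendsto_nhds_unique (hcover.integral_tendsto_of_countably_generated hint) ?_
    simp only [(hp.setIntegral_price hν _).2]
    exact tendsto_const_nhds
  refine ⟨(integrable_map_measure hm.aestronglyMeasurable hpair).1 hint, ?_⟩
  rw [hνdef, integral_map hpair hm.aestronglyMeasurable] at hzero
  exact hzero

/-- Complementary slackness: an assignment supported by a multiplier is the unique solution. -/
theorem isSolution_and_unique (hp : M.Supports α p T) (hT : AEMeasurable T M.prior)
    (hν : M.Feasible (M.prior.map fun θ => (θ, T θ))) (hα : AEMeasurable α M.prior) {K : ℝ}
    (hK : ∀ θ ∈ Icc (0 : ℝ) 1, |α θ| ≤ K) :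
    M.IsSolution α (M.prior.map fun θ => (θ, T θ)) ∧
      ∀ π, M.IsSolution α π → π = M.prior.map fun θ => (θ, T θ) := by
  have hpair : AEMeasurable (fun θ => (θ, T θ)) M.prior := aemeasurable_id.prodMk hT
  set ν := M.prior.map fun θ => (θ, T θ) with hνdef
  obtain ⟨hψ, hψ0⟩ := hp.integrable_price hT hν
  have hν1 := hν.integrable_indicator hα hK
  have hTα : Integrable (fun θ => (Ici M.θs).indicator (fun _ => α θ) (T θ)) M.prior := by
    exact (integrable_map_measure hν1.aestronglyMeasurable hpair).1 hν1
  set φ : ℝ → ℝ := fun θ => (Ici M.θs).indicator (fun _ => α θ) (T θ) - p (T θ) * (T θ - θ)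
  have hφ : Integrable φ M.prior := hTα.sub hψ
  have hφV : ∫ θ, φ θ ∂M.prior = M.volumeOfTrade α ν := by
    rw [integral_sub hTα hψ, hψ0, sub_zero, volumeOfTrade, hνdef,
      integral_map hpair hν1.aestronglyMeasurable]
    rfl
  have key : ∀ π, M.Feasible π → M.volumeOfTrade α π ≤ M.volumeOfTrade α ν ∧
      (M.volumeOfTrade α ν ≤ M.volumeOfTrade α π → π = ν) := by
    intro π hπ
    have := hπ.prob
    have hπ1 := hπ.integrable_indicator hα hK
    have hφπ : Integrable (fun z : ℝ × ℝ => φ z.1) π := by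
      have h := hφ
      rw [← hπ.map_fst] at h
      exact h.comp_measurable measurable_fst
    set slack : ℝ × ℝ → ℝ := fun z => φ z.1 - {z : ℝ × ℝ | M.θs ≤ z.2}.indicator (fun z => α z.1) z
    have hslack : Integrable slack π := hφπ.sub hπ1
    have hslackV : ∫ z, slack z ∂π = M.volumeOfTrade α ν - M.volumeOfTrade α π := by
      rw [integral_sub hφπ hπ1, ← hφV, ← hπ.map_fst]
      congr 1
      rw [integral_map measurable_fst.aemeasurable (hπ.map_fst.symm ▸ hφ.aestronglyMeasurable)]
    have hgap : ∀ᵐ z ∂π, z.2 ≠ T z.1 → 0 < slack z + p z.2 * (z.2 - z.1) := by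
      filter_upwards [hπ.ae_fst hp.gap, hπ.support, hπ.ae_auxCost_le, hπ.ae_snd_ne]
        with z h1 h2 h3 h4 h5
      have := h1 z.2 h2.2 h3 h4 h5
      have e : {z : ℝ × ℝ | M.θs ≤ z.2}.indicator (fun z => α z.1) z =
        (Ici M.θs).indicator (fun _ => α z.1) z.2 := rfl
      simp only [slack, φ, e]
      linarith
    have hgap0 : ∀ᵐ z ∂π, 0 ≤ slack z + p z.2 * (z.2 - z.1) := by
      filter_upwards [hgap] with z h
      by_cases hz : z.2 = T z.1
      · have e : {z : ℝ × ℝ | M.θs ≤ z.2}.indicator (fun z => α z.1) z =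
          (Ici M.θs).indicator (fun _ => α z.1) z.2 := rfl
        simp only [slack, φ, e, hz]
        linarith
      · exact (h hz).le
    have hmono : Monotone fun n => (univ ×ˢ M.awayFrom n : Set (ℝ × ℝ)) := fun m n h =>
      prod_mono subset_rfl (awayFrom_mono h)
    have hmeas : ∀ n, MeasurableSet (univ ×ˢ M.awayFrom n : Set (ℝ × ℝ)) := fun n =>
      MeasurableSet.univ.prod (measurableSet_awayFrom n)
    have hlim : Filter.Tendsto (fun n => ∫ z in univ ×ˢ M.awayFrom n, slack z ∂π) Filter.atTop
        (𝓝 (M.volumeOfTrade α ν - M.volumeOfTrade α π)) := by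
      have := tendsto_setIntegral_of_monotone (μ := π) (f := slack) hmeas hmono hslack.integrableOn
      rwa [iUnion_univ_prod_awayFrom, setIntegral_univ, hslackV] at this
    have hint : ∀ n, IntegrableOn (fun z : ℝ × ℝ => slack z + p z.2 * (z.2 - z.1))
        (univ ×ˢ M.awayFrom n) π := fun n =>
      hslack.integrableOn.add (hp.setIntegral_price hπ n).1
    have hval : ∀ n, ∫ z in univ ×ˢ M.awayFrom n, slack z ∂π =
        ∫ z in univ ×ˢ M.awayFrom n, (slack z + p z.2 * (z.2 - z.1)) ∂π := fun n => by
      rw [integral_add hslack.integrableOn (hp.setIntegral_price hπ n).1,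
        (hp.setIntegral_price hπ n).2, add_zero]
    have hnn : ∀ n, 0 ≤ ∫ z in univ ×ˢ M.awayFrom n, slack z ∂π := fun n => by
      rw [hval]
      exact integral_nonneg_of_ae (ae_restrict_of_ae hgap0)
    refine ⟨sub_nonneg.1 (ge_of_tendsto' hlim hnn), fun hle => ?_⟩
    have hmonoI : Monotone fun n => ∫ z in univ ×ˢ M.awayFrom n, slack z ∂π := fun m n h => by
      beta_reduce
      rw [hval, hval]
      exact setIntegral_mono_set (hint n) (ae_restrict_of_ae hgap0) (hmono h).eventuallyLE
    have hz : ∀ n, ∀ᵐ z ∂π, z ∈ univ ×ˢ M.awayFrom n → slack z + p z.2 * (z.2 - z.1) = 0 := by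
      intro n
      have h0 : ∫ z in univ ×ˢ M.awayFrom n, (slack z + p z.2 * (z.2 - z.1)) ∂π = 0 := by
        rw [← hval]
        refine le_antisymm ((hmonoI.ge_of_tendsto hlim n).trans ?_) (hnn n)
        linarith
      exact (ae_restrict_iff' (hmeas n)).1
        ((setIntegral_eq_zero_iff_of_nonneg_ae (ae_restrict_of_ae hgap0) (hint n)).1 h0)
    refine hπ.eq_map hT ?_
    filter_upwards [ae_all_iff.2 hz, hgap] with z h1 h2
    by_contra hne
    have hz : z.2 ∈ ⋃ n, M.awayFrom n := by rw [iUnion_awayFrom]; trivial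
    obtain ⟨n, hn⟩ := mem_iUnion.1 hz
    exact (h2 hne).ne' (h1 n ⟨trivial, hn⟩)
  refine ⟨⟨hν, fun π' hπ' => (key π' hπ').1⟩, fun π hπ => (key π hπ.1).2 (hπ.2 ν hν)⟩

end Supports

/-! ### Pool–reveal–pool assignments -/

/-- The cutoffs `θ₁ = g₁⁻¹(x)` and `θ₂ = g₂⁻¹(x)` of the pool-reveal-pool assignment are in
order. -/
structure OrderedCutoffs (M : Market) (g₁ g₂ : ℝ → ℝ) (θbar θlow x : ℝ) : Prop where
  first : M.IsMatching g₁ 0 θbar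
  second : M.IsMatching g₂ θlow M.θs
  mem : x ∈ Ioo M.θs (M.c 1)
  lt : inv g₁ 0 θbar x < inv g₂ θlow M.θs x

namespace OrderedCutoffs

variable {g₁ g₂ : ℝ → ℝ} {θbar θlow x : ℝ}

lemma mem_Icc (h : M.OrderedCutoffs g₁ g₂ θbar θlow x) : x ∈ Icc M.θs (M.c 1) :=
  ⟨h.mem.1.le, h.mem.2.le⟩

lemma first_pos (h : M.OrderedCutoffs g₁ g₂ θbar θlow x) : 0 < inv g₁ 0 θbar x := by
  have := h.first.strictAntiOn_inv h.mem_Icc ⟨M.θs_lt_c_one.le, le_rfl⟩ h.mem.2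
  rwa [h.first.inv_c_one] at this

lemma second_lt (h : M.OrderedCutoffs g₁ g₂ θbar θlow x) : inv g₂ θlow M.θs x < M.θs := by
  have := h.second.strictAntiOn_inv ⟨le_rfl, M.θs_lt_c_one.le⟩ h.mem_Icc h.mem.1
  rwa [h.second.inv_θs] at this

lemma namMap_low {θ : ℝ} (hθ : θ ≤ inv g₁ 0 θbar x) : M.namMap g₁ g₂ θbar θlow x θ = g₁ θ :=
  if_pos hθ

lemma namMap_mid {θ : ℝ} (h1 : inv g₁ 0 θbar x < θ)
    (h2 : θ < inv g₂ θlow M.θs x) : M.namMap g₁ g₂ θbar θlow x θ = θ := by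
  rw [namMap, if_neg (not_le.2 h1), if_pos h2]

lemma namMap_high (h : M.OrderedCutoffs g₁ g₂ θbar θlow x) {θ : ℝ} (h1 : inv g₂ θlow M.θs x ≤ θ)
    (h2 : θ ≤ M.θs) : M.namMap g₁ g₂ θbar θlow x θ = g₂ θ := by
  rw [namMap, if_neg (not_le.2 (h.lt.trans_le h1)), if_neg (not_lt.2 h1), if_pos h2]

lemma namMap_top (h : M.OrderedCutoffs g₁ g₂ θbar θlow x) {θ : ℝ} (h1 : M.θs < θ) :
    M.namMap g₁ g₂ θbar θlow x θ = M.c θ := by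
  have h2 := h.second_lt
  have h3 := h.lt
  rw [namMap, if_neg (by linarith), if_neg (by linarith), if_neg (by linarith)]

lemma low_subset (h : M.OrderedCutoffs g₁ g₂ θbar θlow x) :
    Icc 0 (inv g₁ 0 θbar x) ⊆ Icc 0 θbar :=
  Icc_subset_Icc_right (h.first.inv_mem h.mem_Icc).2

lemma high_subset (h : M.OrderedCutoffs g₁ g₂ θbar θlow x) :
    Icc (inv g₂ θlow M.θs x) M.θs ⊆ Icc θlow M.θs :=
  Icc_subset_Icc_left (h.second.inv_mem h.mem_Icc).1

lemma cover {θ : ℝ} (hθ : θ ∈ Icc (0 : ℝ) 1) :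
    θ ∈ Icc 0 (inv g₁ 0 θbar x) ∨ θ ∈ Ioo (inv g₁ 0 θbar x) (inv g₂ θlow M.θs x) ∨
      θ ∈ Icc (inv g₂ θlow M.θs x) M.θs ∨ θ ∈ Ioc M.θs 1 := by
  rcases le_or_gt θ (inv g₁ 0 θbar x) with h1 | h1
  · exact Or.inl ⟨hθ.1, h1⟩
  rcases lt_or_ge θ (inv g₂ θlow M.θs x) with h2 | h2
  · exact Or.inr (Or.inl ⟨h1, h2⟩)
  rcases le_or_gt θ M.θs with h3 | h3
  · exact Or.inr (Or.inr (Or.inl ⟨h2, h3⟩))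
  · exact Or.inr (Or.inr (Or.inr ⟨h3, hθ.2⟩))

lemma aemeasurable_namMap (h : M.OrderedCutoffs g₁ g₂ θbar θlow x) :
    AEMeasurable (M.namMap g₁ g₂ θbar θlow x) M.prior := by
  have hcover : Icc (0 : ℝ) 1 ⊆ Icc 0 (inv g₁ 0 θbar x) ∪
      (Ioo (inv g₁ 0 θbar x) (inv g₂ θlow M.θs x) ∪
        (Icc (inv g₂ θlow M.θs x) M.θs ∪ Ioc M.θs 1)) := fun θ hθ => cover hθ
  rw [← M.prior_restrict_Icc]
  refine AEMeasurable.mono_measure ?_ (Measure.restrict_mono hcover le_rfl)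
  refine aemeasurable_union_iff.2 ⟨?_, aemeasurable_union_iff.2 ⟨?_,
    aemeasurable_union_iff.2 ⟨?_, ?_⟩⟩⟩
  · exact aemeasurable_restrict_of_antitoneOn measurableSet_Icc
      ((h.first.strictAnti.antitoneOn.mono h.low_subset).congr
        fun θ hθ => (namMap_low hθ.2).symm)
  · exact aemeasurable_restrict_of_monotoneOn measurableSet_Ioo
      ((monotone_id.monotoneOn _).congr fun θ hθ => (namMap_mid hθ.1 hθ.2).symm)
  · exact aemeasurable_restrict_of_antitoneOn measurableSet_Icc
      ((h.second.strictAnti.antitoneOn.mono h.high_subset).congr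
        fun θ hθ => (h.namMap_high hθ.1 hθ.2).symm)
  · exact aemeasurable_restrict_of_monotoneOn measurableSet_Ioc
      ((M.c_strictMonoOn_top.monotoneOn.mono Ioc_subset_Icc_self).congr
        fun θ hθ => (h.namMap_top hθ.1).symm)

lemma feasible_nam (h : M.OrderedCutoffs g₁ g₂ θbar θlow x) :
    M.Feasible (M.nam g₁ g₂ θbar θlow x) := by
  set T := M.namMap g₁ g₂ θbar θlow x with hT
  have hθ0 := M.θs_pos
  have hθ1 := M.θs_lt_one
  have hc1 := M.c_one_lt_one
  have hlow : ∀ θ ∈ Icc 0 (inv g₁ 0 θbar x), T θ ∈ Icc M.θs (M.c 1) := fun θ hθ => by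
    rw [hT, namMap_low hθ.2]; exact h.first.bijOn.mapsTo (h.low_subset hθ)
  have hhigh : ∀ θ ∈ Icc (inv g₂ θlow M.θs x) M.θs, T θ ∈ Icc M.θs (M.c 1) := fun θ hθ => by
    rw [hT, h.namMap_high hθ.1 hθ.2]; exact h.second.bijOn.mapsTo (h.high_subset hθ)
  have hT01 : ∀ᵐ θ ∂M.prior, T θ ∈ Icc (0 : ℝ) 1 := by
    filter_upwards [M.ae_prior_mem_Icc] with θ hθ
    rcases cover hθ with h' | h' | h' | h'
    · exact ⟨hθ0.le.trans (hlow θ h').1, (hlow θ h').2.trans hc1.le⟩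
    · rw [hT, namMap_mid h'.1 h'.2]; exact hθ
    · exact ⟨hθ0.le.trans (hhigh θ h').1, (hhigh θ h').2.trans hc1.le⟩
    · rw [hT, h.namMap_top h'.1]
      exact ⟨(M.c_pos θ hθ).le, (M.c_above θ h').le.trans hθ.2⟩
  have hint := integrable_sub_id h.aemeasurable_namMap hT01
  obtain ⟨t, ht, rfl⟩ := M.c_bijOn.surjOn h.mem_Icc
  have hmem : M.θs ∈ Icc M.θs 1 := ⟨le_rfl, hθ1.le⟩
  have hmem1 : (1 : ℝ) ∈ Icc M.θs 1 := ⟨hθ1.le, le_rfl⟩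
  have hA₁ := h.first.isPooling
  have hA₂ := h.second.isPooling
  have himg₁ := hA₁.image_Ioc ht hmem1 ht.2
  have himg₂ := hA₂.image_Ioc hmem ht ht.1
  rw [h.first.inv_c_one] at himg₁
  rw [M.c_θs, h.second.inv_θs] at himg₂
  have hbal₁ := hA₁.balanced (T := T) (E := Ioc t 1) measurableSet_Ioc
    (Ioc_subset_Ioc_left ht.1)
    (fun s hs => by
      have hs1 : s ∈ Icc M.θs 1 := ⟨ht.1.trans hs.1.le, hs.2⟩
      rw [hT, namMap_low (h.first.strictAntiOn_inv.antitoneOn h.mem_Icc (M.c_bijOn.mapsTo hs1)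
        (M.c_strictMonoOn_top.monotoneOn ht hs1 hs.1.le)),
        h.first.apply_inv (M.c_bijOn.mapsTo hs1)])
    (fun s hs => h.namMap_top (ht.1.trans_lt hs.1)) hint
  have hbal₂ := hA₂.balanced (T := T) (E := Ioc M.θs t) measurableSet_Ioc
    (Ioc_subset_Ioc_right ht.2)
    (fun s hs => by
      have hs1 : s ∈ Icc M.θs 1 := ⟨hs.1.le, hs.2.trans ht.2⟩
      rw [hT, h.namMap_high (h.second.strictAntiOn_inv.antitoneOn (M.c_bijOn.mapsTo hs1) h.mem_Icc
        (M.c_strictMonoOn_top.monotoneOn hs1 ht hs.2)) (h.second.inv_mem (M.c_bijOn.mapsTo hs1)).2,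
        h.second.apply_inv (M.c_bijOn.mapsTo hs1)])
    (fun s hs => h.namMap_top hs.1) hint
  rw [himg₁] at hbal₁
  rw [himg₂] at hbal₂
  have hl := h.lt
  have h2 := h.second_lt
  have hd : Disjoint (Ico 0 (inv g₁ 0 θbar (M.c t)) ∪ Ioc t 1)
      (Ico (inv g₂ θlow M.θs (M.c t)) M.θs ∪ Ioc M.θs t) := by
    rw [disjoint_left]
    rintro θ (hθ | hθ) (hθ' | hθ')
    · linarith [hθ.2, hθ'.1]
    · linarith [hθ.2, hθ'.1]
    · linarith [hθ.1, hθ'.2, ht.1]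
    · linarith [hθ.1, hθ'.2]
  refine feasible_map h.aemeasurable_namMap hT01 ?_ (hbal₁.union hbal₂ hd hint) ?_
  · filter_upwards [M.ae_prior_mem_Icc] with θ hθ
    rcases cover hθ with h' | h' | h' | h'
    · exact (min_le_left _ _).trans (by linarith [h'.2, (hlow θ h').1])
    · exact (min_le_left _ _).trans (namMap_mid h'.1 h'.2).ge
    · exact (min_le_left _ _).trans (h'.2.trans (hhigh θ h').1)
    · exact (min_le_right _ _).trans (h.namMap_top h'.1).ge
  · filter_upwards [M.ae_prior_mem_Icc, M.ae_prior_ne (inv g₁ 0 θbar (M.c t)),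
      M.ae_prior_ne M.θs] with θ hθ hne1 hne2 hnot
    rcases cover hθ with h' | h' | h' | h'
    · exact absurd (Or.inl (Or.inl ⟨h'.1, lt_of_le_of_ne h'.2 hne1⟩)) hnot
    · exact namMap_mid h'.1 h'.2
    · exact absurd (Or.inr (Or.inl ⟨h'.1, lt_of_le_of_ne h'.2 hne2⟩)) hnot
    · rcases le_or_gt θ t with hle | hlt
      · exact absurd (Or.inr (Or.inr ⟨h'.1, hle⟩)) hnot
      · exact absurd (Or.inl (Or.inr ⟨hlt, h'.2⟩)) hnot

end OrderedCutoffs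

/-! ### The multiplier -/

/-- The function `p` with `p(x) = P` and `p'/p = -1/(y - a(y))` on `(b, ∞)`, so that `y` is the
critical point of `p(y)(y - θ)` for `θ = a(y)`; its value `1` on `(-∞, b]` is an arbitrary
positive constant. -/
noncomputable def multiplier (b x P : ℝ) (a : ℝ → ℝ) (y : ℝ) : ℝ :=
  if y ≤ b then 1 else P * Real.exp (-∫ s in x..y, (s - a s)⁻¹)

section Multiplier

variable {b x P : ℝ} {a : ℝ → ℝ}

lemma inv_sub_antitoneOn (ha : AntitoneOn a (Ioi b)) (hab : ∀ y, b < y → a y ≤ b) :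
    AntitoneOn (fun s => (s - a s)⁻¹) (Ioi b) := by
  intro s hs t ht hst
  have h1 := ha hs ht hst
  have h2 := hab s hs
  have hs' : b < s := hs
  exact inv_anti₀ (by linarith) (by linarith)

lemma intervalIntegrable_inv_sub (ha : AntitoneOn a (Ioi b)) (hab : ∀ y, b < y → a y ≤ b)
    {s t : ℝ} (hs : b < s) (ht : b < t) :
    IntervalIntegrable (fun s => (s - a s)⁻¹) volume s t :=
  ((inv_sub_antitoneOn ha hab).mono
    fun _ hr => (lt_inf_iff.2 ⟨hs, ht⟩).trans_le hr.1).intervalIntegrable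

lemma multiplier_of_lt {y : ℝ} (hy : b < y) :
    multiplier b x P a y = P * Real.exp (-∫ s in x..y, (s - a s)⁻¹) := if_neg (not_le.2 hy)

lemma multiplier_of_le {y : ℝ} (hy : y ≤ b) : multiplier b x P a y = 1 := if_pos hy

lemma multiplier_self (hx : b < x) : multiplier b x P a x = P := by
  simp [multiplier_of_lt hx]

lemma multiplier_pos (hP : 0 < P) (y : ℝ) : 0 < multiplier b x P a y := by
  unfold multiplier
  split_ifs
  · exact one_pos
  · positivity

lemma multiplier_antitoneOn (ha : AntitoneOn a (Ioi b)) (hab : ∀ y, b < y → a y ≤ b)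
    (hx : b < x) (hP : 0 < P) : AntitoneOn (multiplier b x P a) (Ioi b) := by
  intro s hs t ht hst
  have hs' : b < s := hs
  have ht' : b < t := ht
  rw [multiplier_of_lt hs', multiplier_of_lt ht']
  have h1 := intervalIntegral.integral_add_adjacent_intervals
    (intervalIntegrable_inv_sub ha hab hx hs') (intervalIntegrable_inv_sub ha hab hs' ht')
  have h2 : 0 ≤ ∫ r in s..t, (r - a r)⁻¹ :=
    intervalIntegral.integral_nonneg hst fun r hr => by
      have := hab r (hs'.trans_le hr.1)
      exact inv_nonneg.2 (by linarith [hr.1])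
  gcongr
  linarith

lemma measurable_multiplier (ha : AntitoneOn a (Ioi b)) (hab : ∀ y, b < y → a y ≤ b)
    (hx : b < x) (hP : 0 < P) : Measurable (multiplier b x P a) := by
  refine measurable_of_restrict_of_restrict_compl (s := Ioi b) measurableSet_Ioi ?_ ?_
  · have : Antitone ((Ioi b).domRestrict (multiplier b x P a)) := fun s t hst =>
      multiplier_antitoneOn ha hab hx hP s.2 t.2 hst
    exact this.measurable
  · have : (Ioi b)ᶜ.domRestrict (multiplier b x P a) = fun _ => 1 := by
      ext s
      exact multiplier_of_le (not_lt.1 s.2)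
    exact this ▸ measurable_const

lemma integral_inv_sub_const {θ s t : ℝ} (hs : θ < s) (ht : θ < t) :
    ∫ r in s..t, (r - θ)⁻¹ = Real.log (t - θ) - Real.log (s - θ) := by
  rw [intervalIntegral.integral_comp_sub_right (fun r => r⁻¹) θ,
    integral_inv_of_pos (by linarith) (by linarith), Real.log_div (by linarith) (by linarith)]

/-- The price `p(z)(z - θ)` of the type `θ` is strictly single-dipped in `z`, with minimum where
`a` crosses `θ`. -/
lemma multiplier_mul_sub_lt (ha : AntitoneOn a (Ioi b)) (hab : ∀ y, b < y → a y ≤ b)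
    (hx : b < x) (hP : 0 < P) {θ y z : ℝ} (hθ : θ ≤ b) (hy : b < y) (hz : b < z) (hyz : z ≠ y)
    (hright : ∀ s, y < s → a s < θ) (hleft : ∀ s, b < s → s < y → θ < a s) :
    multiplier b x P a y * (y - θ) < multiplier b x P a z * (z - θ) := by
  have hcont : ∀ s t : ℝ, b < s → b < t →
      IntervalIntegrable (fun r => (r - θ)⁻¹) volume s t := fun s t hs ht => by
    refine ContinuousOn.intervalIntegrable (ContinuousOn.inv₀ (by fun_prop) fun r hr => ?_)
    have : b < r := (lt_inf_iff.2 ⟨hs, ht⟩).trans_le hr.1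
    linarith
  have hk := fun s t hs ht => intervalIntegrable_inv_sub (s := s) (t := t) ha hab hs ht
  have hadd := intervalIntegral.integral_add_adjacent_intervals (hk x y hx hy) (hk y z hy hz)
  -- In logarithms the claim is `∫ r in y..z, 1/(r - a(r)) < ∫ r in y..z, 1/(r - θ)`.
  have key : ∫ r in y..z, (r - a r)⁻¹ < ∫ r in y..z, (r - θ)⁻¹ := by
    rcases lt_or_gt_of_ne hyz with h | h
    · rw [intervalIntegral.integral_symm z y, intervalIntegral.integral_symm z y, neg_lt_neg_iff,
        ← sub_pos, ← intervalIntegral.integral_sub (hk z y hz hy) (hcont z y hz hy)]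
      refine intervalIntegral.intervalIntegral_pos_of_pos_on ((hk z y hz hy).sub (hcont z y hz hy))
        (fun r hr => ?_) h
      have h1 := hleft r (hz.trans hr.1) hr.2
      have h2 := hab r (hz.trans hr.1)
      exact sub_pos.2 (inv_strictAnti₀ (by linarith [hr.1]) (by linarith))
    · rw [← sub_pos, ← intervalIntegral.integral_sub (hcont y z hy hz) (hk y z hy hz)]
      refine intervalIntegral.intervalIntegral_pos_of_pos_on ((hcont y z hy hz).sub (hk y z hy hz))
        (fun r hr => ?_) h
      have h1 := hright r hr.1
      exact sub_pos.2 (inv_strictAnti₀ (by linarith [hr.1]) (by linarith))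
  rw [integral_inv_sub_const (by linarith) (by linarith)] at key
  have hexp : ∀ s, b < s → multiplier b x P a s * (s - θ) =
      P * Real.exp (Real.log (s - θ) - ∫ r in x..s, (r - a r)⁻¹) := fun s hs => by
    rw [multiplier_of_lt hs, sub_eq_add_neg (Real.log _), Real.exp_add,
      Real.exp_log (by linarith)]
    ring
  rw [hexp y hy, hexp z hz]
  exact mul_lt_mul_of_pos_left (Real.exp_lt_exp.2 (by linarith)) hP

end Multiplier

/-! ### Optimality of the pool–reveal–pool assignment -/

/-- The inefficient type pooled at the posterior mean `y` in the assignment with parameter `x`,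
extended by `0` above `c(1)`. -/
noncomputable def partner (M : Market) (g₁ g₂ : ℝ → ℝ) (θbar θlow x y : ℝ) : ℝ :=
  if y < x then inv g₂ θlow M.θs y else if y ≤ M.c 1 then inv g₁ 0 θbar y else 0

namespace OrderedCutoffs

variable {g₁ g₂ : ℝ → ℝ} {θbar θlow x : ℝ}

lemma partner_of_lt {y : ℝ} (hy : y < x) :
    M.partner g₁ g₂ θbar θlow x y = inv g₂ θlow M.θs y := if_pos hy

lemma partner_of_ge {y : ℝ} (hy : x ≤ y) (hy1 : y ≤ M.c 1) :
    M.partner g₁ g₂ θbar θlow x y = inv g₁ 0 θbar y := by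
  rw [partner, if_neg (not_lt.2 hy), if_pos hy1]

lemma second_inv_mem (h : M.OrderedCutoffs g₁ g₂ θbar θlow x) {y : ℝ} (hy : M.θs < y)
    (hyx : y < x) : y ∈ Icc M.θs (M.c 1) := ⟨hy.le, hyx.le.trans h.mem.2.le⟩

lemma first_inv_mem (h : M.OrderedCutoffs g₁ g₂ θbar θlow x) {y : ℝ} (hy : x ≤ y)
    (hy1 : y ≤ M.c 1) : y ∈ Icc M.θs (M.c 1) := ⟨h.mem.1.le.trans hy, hy1⟩

lemma lt_partner (h : M.OrderedCutoffs g₁ g₂ θbar θlow x) {y : ℝ} (hy : M.θs < y) (hyx : y < x) :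
    inv g₂ θlow M.θs x < M.partner g₁ g₂ θbar θlow x y := by
  rw [partner_of_lt hyx]
  exact h.second.strictAntiOn_inv (h.second_inv_mem hy hyx) h.mem_Icc hyx

lemma partner_le (h : M.OrderedCutoffs g₁ g₂ θbar θlow x) {y : ℝ} (hyx : x ≤ y) :
    M.partner g₁ g₂ θbar θlow x y ≤ inv g₁ 0 θbar x := by
  rcases le_or_gt y (M.c 1) with hy1 | hy1
  · rw [partner_of_ge hyx hy1]
    exact h.first.strictAntiOn_inv.antitoneOn h.mem_Icc (h.first_inv_mem hyx hy1) hyx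
  · rw [partner, if_neg (not_lt.2 hyx), if_neg (not_le.2 hy1)]
    exact h.first_pos.le

lemma partner_lt (h : M.OrderedCutoffs g₁ g₂ θbar θlow x) {y : ℝ} (hyx : x < y) :
    M.partner g₁ g₂ θbar θlow x y < inv g₁ 0 θbar x := by
  rcases le_or_gt y (M.c 1) with hy1 | hy1
  · rw [partner_of_ge hyx.le hy1]
    exact h.first.strictAntiOn_inv h.mem_Icc (h.first_inv_mem hyx.le hy1) hyx
  · rw [partner, if_neg (not_lt.2 hyx.le), if_neg (not_le.2 hy1)]
    exact h.first_pos

lemma partner_le_θs (h : M.OrderedCutoffs g₁ g₂ θbar θlow x) (y : ℝ) (hy : M.θs < y) :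
    M.partner g₁ g₂ θbar θlow x y ≤ M.θs := by
  rcases lt_or_ge y x with hyx | hyx
  · rw [partner_of_lt hyx]
    exact (h.second.inv_mem (h.second_inv_mem hy hyx)).2
  · linarith [h.partner_le hyx, h.lt, h.second_lt]

lemma partner_antitoneOn (h : M.OrderedCutoffs g₁ g₂ θbar θlow x) :
    AntitoneOn (M.partner g₁ g₂ θbar θlow x) (Ioi M.θs) := by
  intro y hy z hz hyz
  rcases lt_or_ge z x with hzx | hzx
  · have hyx := hyz.trans_lt hzx
    rw [partner_of_lt hzx, partner_of_lt hyx]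
    exact h.second.strictAntiOn_inv.antitoneOn (h.second_inv_mem hy hyx)
      (h.second_inv_mem hz hzx) hyz
  rcases lt_or_ge y x with hyx | hyx
  · linarith [h.partner_le hzx, h.lt, h.lt_partner hy hyx]
  rcases le_or_gt z (M.c 1) with hz1 | hz1
  · rw [partner_of_ge hzx hz1, partner_of_ge hyx (hyz.trans hz1)]
    exact h.first.strictAntiOn_inv.antitoneOn (h.first_inv_mem hyx (hyz.trans hz1))
      (h.first_inv_mem hzx hz1) hyz
  · rw [partner, if_neg (not_lt.2 hzx), if_neg (not_le.2 hz1)]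
    rcases le_or_gt y (M.c 1) with hy1 | hy1
    · rw [partner_of_ge hyx hy1]
      exact (h.first.inv_mem (h.first_inv_mem hyx hy1)).1
    · rw [partner, if_neg (not_lt.2 hyx), if_neg (not_le.2 hy1)]

/-- `partner` crosses the level of a low type `θ` exactly at `g₁ θ`. -/
lemma partner_cross_low (h : M.OrderedCutoffs g₁ g₂ θbar θlow x) {θ : ℝ} (hθ0 : 0 < θ)
    (hθ : θ < inv g₁ 0 θbar x) :
    g₁ θ ∈ Ioc x (M.c 1) ∧ (∀ s, g₁ θ < s → M.partner g₁ g₂ θbar θlow x s < θ) ∧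
      ∀ s, M.θs < s → s < g₁ θ → θ < M.partner g₁ g₂ θbar θlow x s := by
  have hmem : θ ∈ Icc 0 θbar := h.low_subset ⟨hθ0.le, hθ.le⟩
  have hmem' : inv g₁ 0 θbar x ∈ Icc 0 θbar := h.first.inv_mem h.mem_Icc
  have hx : x < g₁ θ := by
    have := h.first.strictAnti hmem hmem' hθ
    rwa [h.first.apply_inv h.mem_Icc] at this
  have hg := h.first.bijOn.mapsTo hmem
  have hinv := h.first.inv_apply hmem
  refine ⟨⟨hx, hg.2⟩, fun s hs => ?_, fun s hs hsθ => ?_⟩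
  · rcases le_or_gt s (M.c 1) with hs1 | hs1
    · rw [partner_of_ge (hx.trans hs).le hs1]
      exact (h.first.strictAntiOn_inv hg (h.first_inv_mem (hx.trans hs).le hs1) hs).trans_eq hinv
    · rw [partner, if_neg (not_lt.2 (hx.trans hs).le), if_neg (not_le.2 hs1)]
      exact hθ0
  · rcases lt_or_ge s x with hsx | hsx
    · linarith [h.lt_partner hs hsx, h.lt]
    · rw [partner_of_ge hsx (hsθ.le.trans hg.2)]
      exact hinv.symm.trans_lt
        (h.first.strictAntiOn_inv (h.first_inv_mem hsx (hsθ.le.trans hg.2)) hg hsθ)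

/-- `partner` crosses the level of a high inefficient type `θ` exactly at `g₂ θ`. -/
lemma partner_cross_high (h : M.OrderedCutoffs g₁ g₂ θbar θlow x) {θ : ℝ}
    (hθ : inv g₂ θlow M.θs x < θ) (hθs : θ < M.θs) :
    g₂ θ ∈ Ioo M.θs x ∧ (∀ s, g₂ θ < s → M.partner g₁ g₂ θbar θlow x s < θ) ∧
      ∀ s, M.θs < s → s < g₂ θ → θ < M.partner g₁ g₂ θbar θlow x s := by
  have hmem : θ ∈ Icc θlow M.θs := h.high_subset ⟨hθ.le, hθs.le⟩
  have hmem' : inv g₂ θlow M.θs x ∈ Icc θlow M.θs := h.second.inv_mem h.mem_Icc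
  have hθsmem : M.θs ∈ Icc θlow M.θs := ⟨hmem.1.trans hmem.2, le_rfl⟩
  have hx : g₂ θ < x := by
    have := h.second.strictAnti hmem' hmem hθ
    rwa [h.second.apply_inv h.mem_Icc] at this
  have hg := h.second.bijOn.mapsTo hmem
  have hinv := h.second.inv_apply hmem
  have hθg : M.θs < g₂ θ :=
    (h.second.bijOn.mapsTo hθsmem).1.trans_lt (h.second.strictAnti hmem hθsmem hθs)
  refine ⟨⟨hθg, hx⟩, fun s hs => ?_, fun s hs hsθ => ?_⟩
  · rcases lt_or_ge s x with hsx | hsx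
    · rw [partner_of_lt hsx]
      exact (h.second.strictAntiOn_inv hg (h.second_inv_mem (hθg.trans hs) hsx) hs).trans_eq hinv
    · linarith [h.partner_le hsx, h.lt]
  · rw [partner_of_lt (hsθ.trans hx)]
    exact hinv.symm.trans_lt
      (h.second.strictAntiOn_inv (h.second_inv_mem hs (hsθ.trans hx)) hg hsθ)

end OrderedCutoffs

lemma level_of_strictConvexOn {s : Set ℝ} {φ : ℝ → ℝ} (hφ : StrictConvexOn ℝ s φ) {a b P : ℝ}
    (ha : a ∈ s) (hb : b ∈ s) (hab : a < b) (hφa : φ a = P) (hφb : φ b = P) :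
    (∀ r ∈ Ioo a b, φ r < P) ∧ (∀ r ∈ s, r < a → P < φ r) ∧ ∀ r ∈ s, b < r → P < φ r := by
  refine ⟨fun r hr => ?_, fun r hr h => ?_, fun r hr h => ?_⟩
  · have := hφ.slope_strict_mono_adjacent ha hb hr.1 hr.2
    rw [hφa, hφb] at this
    by_contra! hle
    have h1 : 0 ≤ (φ r - P) / (r - a) := div_nonneg (by linarith) (by linarith [hr.1])
    have h2 : (P - φ r) / (b - r) ≤ 0 :=
      div_nonpos_of_nonpos_of_nonneg (by linarith) (by linarith [hr.2])
    linarith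
  · have := hφ.slope_strict_mono_adjacent hr hb h hab
    rw [hφa, hφb, sub_self, zero_div, div_neg_iff] at this
    rcases this with h' | h' <;> linarith [h'.1, h'.2]
  · have := hφ.slope_strict_mono_adjacent ha hr hab h
    rw [hφa, hφb, sub_self, zero_div, div_pos_iff] at this
    rcases this with h' | h' <;> linarith [h'.1, h'.2]

/-- If the types `θ₁` and `θ₂` have the same ratio `α(θ) / (x - θ)`, this ratio scales the
multiplier so that both are indifferent between trading at `x` and not trading. By strict convexity the types
between them strictly prefer not to trade and the other inefficient types strictly prefer to. -/
theorem OrderedCutoffs.supports {g₁ g₂ : ℝ → ℝ} {θbar θlow x : ℝ}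
    (h : M.OrderedCutoffs g₁ g₂ θbar θlow x) {α : ℝ → ℝ} {P : ℝ} (hP : 0 < P)
    (hα : StrictConvexOn ℝ (Icc 0 M.θs) fun θ => α θ / (x - θ))
    (h₁ : α (inv g₁ 0 θbar x) / (x - inv g₁ 0 θbar x) = P)
    (h₂ : α (inv g₂ θlow M.θs x) / (x - inv g₂ θlow M.θs x) = P) :
    M.Supports α (multiplier M.θs x P (M.partner g₁ g₂ θbar θlow x))
      (M.namMap g₁ g₂ θbar θlow x) := by
  have hθ0 := M.θs_pos
  have hx := h.mem.1
  have hx0 : 0 < x := hθ0.trans hx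
  have hl := h.lt
  have h0 := h.first_pos
  have hs := h.second_lt
  obtain ⟨hmid, hlow, hhigh⟩ := level_of_strictConvexOn hα ⟨h0.le, by linarith⟩
    ⟨by linarith, hs.le⟩ hl h₁ h₂
  set a := M.partner g₁ g₂ θbar θlow x
  set p := multiplier M.θs x P a with hp
  set T := M.namMap g₁ g₂ θbar θlow x
  have ha : AntitoneOn a (Ioi M.θs) := h.partner_antitoneOn
  have hab : ∀ y, M.θs < y → a y ≤ M.θs := h.partner_le_θs
  have hpos : ∀ y, 0 < p y := multiplier_pos hP
  have hanti := multiplier_antitoneOn ha hab hx hP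
  have hpx : p x = P := multiplier_self hx
  have hp1 : ∀ y ≤ M.θs, p y = 1 := fun y hy => multiplier_of_le hy
  have hmin := fun {θ y z : ℝ} => multiplier_mul_sub_lt (θ := θ) (y := y) (z := z) ha hab hx hP
  have hTlow : ∀ θ, 0 < θ → θ < inv g₁ 0 θbar x → x < T θ ∧ p (T θ) * (T θ - θ) < P * (x - θ) ∧
      ∀ z, M.θs < z → z ≠ T θ → p (T θ) * (T θ - θ) < p z * (z - θ) := by
    intro θ hθ hθ1
    obtain ⟨c1, c2, c3⟩ := h.partner_cross_low hθ hθ1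
    rw [← namMap_low (M := M) (g₂ := g₂) (θlow := θlow) hθ1.le] at c1 c2 c3
    have := fun z hz hne => hmin (z := z) (by linarith) (hx.trans c1.1) hz hne c2 c3
    exact ⟨c1.1, hpx ▸ this x hx c1.1.ne, this⟩
  have hThigh : ∀ θ, inv g₂ θlow M.θs x < θ → θ < M.θs →
      M.θs < T θ ∧ p (T θ) * (T θ - θ) < P * (x - θ) ∧
      ∀ z, M.θs < z → z ≠ T θ → p (T θ) * (T θ - θ) < p z * (z - θ) := by
    intro θ hθ hθ1
    obtain ⟨c1, c2, c3⟩ := h.partner_cross_high hθ hθ1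
    rw [← h.namMap_high hθ.le hθ1.le] at c1 c2 c3
    have := fun z hz hne => hmin (z := z) hθ1.le c1.1 hz hne c2 c3
    exact ⟨c1.1, hpx ▸ this x hx c1.2.ne', this⟩
  have hTmid : ∀ θ, inv g₁ 0 θbar x < θ → θ < inv g₂ θlow M.θs x →
      ∀ z, M.θs < z → P * (x - θ) ≤ p z * (z - θ) := by
    intro θ hθ hθ1 z hz
    rcases eq_or_ne z x with rfl | hne
    · rw [hpx]
    · rw [← hpx]
      exact (hmin (by linarith) hx hz hne (fun s hs => (h.partner_lt hs).trans hθ)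
        fun s hs hsx => hθ1.trans (h.lt_partner hs hsx)).le
  have hdiv : ∀ θ < M.θs, (α θ / (x - θ) < P ↔ α θ < P * (x - θ)) ∧
      (P < α θ / (x - θ) ↔ P * (x - θ) < α θ) := fun θ hθ =>
    ⟨div_lt_iff₀ (by linarith), lt_div_iff₀ (by linarith)⟩
  -- Almost every type lies in the interior of one of the four regions.
  have hgood : ∀ᵐ θ ∂M.prior, (0 < θ ∧ θ < inv g₁ 0 θbar x) ∨
      (inv g₁ 0 θbar x < θ ∧ θ < inv g₂ θlow M.θs x) ∨ (inv g₂ θlow M.θs x < θ ∧ θ < M.θs) ∨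
      (M.θs < θ ∧ θ ≤ 1) := by
    filter_upwards [M.ae_prior_mem_Icc, M.ae_prior_ne 0, M.ae_prior_ne (inv g₁ 0 θbar x),
      M.ae_prior_ne (inv g₂ θlow M.θs x), M.ae_prior_ne M.θs] with θ hθ n0 n1 n2 n3
    rcases cover hθ with h' | h' | h' | h'
    · exact Or.inl ⟨lt_of_le_of_ne h'.1 n0.symm, lt_of_le_of_ne h'.2 n1⟩
    · exact Or.inr (Or.inl h')
    · exact Or.inr (Or.inr (Or.inl ⟨lt_of_le_of_ne h'.1 n2.symm, lt_of_le_of_ne h'.2 n3⟩))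
    · exact Or.inr (Or.inr (Or.inr h'))
  refine ⟨measurable_multiplier ha hab hx hP, fun n => ?_, ⟨P * x, by positivity, ?_⟩, ?_, ?_⟩
  · have hε : 0 < 1 / ((n : ℝ) + 1) := by positivity
    refine ⟨max 1 (p (M.θs + 1 / ((n : ℝ) + 1))), fun y hy => ?_⟩
    rw [abs_of_pos (hpos y)]
    rcases le_or_gt y M.θs with h' | h'
    · rw [hp1 y h']; exact le_max_left _ _
    · have : M.θs + 1 / ((n : ℝ) + 1) ≤ y := not_lt.1 fun hlt => hy ⟨h', hlt⟩
      exact (hanti (show M.θs < _ by linarith) h' this).trans (le_max_right _ _)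
  · filter_upwards [hgood] with θ hθ hθle
    have hPθ : 0 ≤ θ → P * (x - θ) ≤ P * x := fun h => by gcongr; linarith
    rcases hθ with ⟨c1, c2⟩ | ⟨c1, c2⟩ | ⟨c1, c2⟩ | ⟨c1, c2⟩
    · obtain ⟨d1, d2, -⟩ := hTlow θ c1 c2
      rw [abs_of_nonneg (mul_nonneg (hpos _).le (by linarith))]
      exact d2.le.trans (hPθ c1.le)
    · rw [show T θ = θ from namMap_mid c1 c2, sub_self, mul_zero, abs_zero]
      positivity
    · obtain ⟨d1, d2, -⟩ := hThigh θ c1 c2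
      rw [abs_of_nonneg (mul_nonneg (hpos _).le (by linarith))]
      exact d2.le.trans (hPθ (by linarith))
    · linarith
  · filter_upwards [M.ae_prior_mem_Icc] with θ hθ hlt
    rw [show T θ = M.c θ from h.namMap_top hlt]
    exact mul_nonpos_of_nonneg_of_nonpos (hpos _).le (by linarith [M.c_above θ ⟨hlt, hθ.2⟩])
  · filter_upwards [hgood] with θ hθ z hz hcost hzne hzT
    have hcost' : 0 ≤ θ → θ < M.θs → θ ≤ z := fun c1 c2 => by
      rwa [auxCost, min_eq_left (M.c_below θ ⟨c1, c2⟩).le] at hcost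
    -- A trading type loses by not trading, where the price is nonnegative.
    have htrade : 0 ≤ θ → θ < M.θs → M.θs < T θ → p (T θ) * (T θ - θ) < P * (x - θ) →
        P < α θ / (x - θ) → (∀ z, M.θs < z → z ≠ T θ → p (T θ) * (T θ - θ) < p z * (z - θ)) →
        (Ici M.θs).indicator (fun _ => α θ) z - p z * (z - θ) <
          (Ici M.θs).indicator (fun _ => α θ) (T θ) - p (T θ) * (T θ - θ) := by
      intro e0 e1 e2 e3 e4 e5
      rw [indicator_of_mem (show T θ ∈ Ici M.θs from e2.le)]
      rcases lt_or_gt_of_ne hzne with hz' | hz'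
      · rw [indicator_of_notMem (show z ∉ Ici M.θs from not_le.2 hz'), hp1 z hz'.le]
        linarith [hcost' e0 e1, (hdiv θ e1).2.1 e4]
      · rw [indicator_of_mem (show z ∈ Ici M.θs from hz'.le)]
        linarith [e5 z hz' hzT]
    rcases hθ with ⟨c1, c2⟩ | ⟨c1, c2⟩ | ⟨c1, c2⟩ | ⟨c1, c2⟩
    · obtain ⟨d1, d2, d3⟩ := hTlow θ c1 c2
      exact htrade c1.le (by linarith) (hx.trans d1) d2 (hlow θ ⟨c1.le, by linarith⟩ c2) d3
    · have hθs : θ < M.θs := by linarith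
      have hT : T θ = θ := namMap_mid c1 c2
      rw [hT, sub_self, mul_zero, indicator_of_notMem (show θ ∉ Ici M.θs from not_le.2 hθs)]
      have hle := hcost' (by linarith) hθs
      rcases lt_or_gt_of_ne hzne with hz' | hz'
      · rw [indicator_of_notMem (show z ∉ Ici M.θs from not_le.2 hz'), hp1 z hz'.le]
        have : θ < z := lt_of_le_of_ne hle fun e => hzT (by rw [hT, e])
        linarith
      · rw [indicator_of_mem (show z ∈ Ici M.θs from hz'.le)]
        linarith [hTmid θ c1 c2 z hz', (hdiv θ hθs).1.1 (hmid θ ⟨c1, c2⟩)]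
    · obtain ⟨d1, d2, d3⟩ := hThigh θ c1 c2
      exact htrade (by linarith) c2 d1 d2 (hhigh θ ⟨by linarith, c2.le⟩ c1) d3
    · have hT : T θ = M.c θ := h.namMap_top c1
      have hc := M.c_above θ ⟨c1, c2⟩
      have hcs := M.θs_lt_c ⟨c1, c2⟩
      rw [hT] at hzT ⊢
      have hz' : M.c θ < z := by
        rw [auxCost, min_eq_right hc.le] at hcost
        exact lt_of_le_of_ne hcost hzT.symm
      rw [indicator_of_mem (show M.c θ ∈ Ici M.θs from hcs.le),
        indicator_of_mem (show z ∈ Ici M.θs from (hcs.trans hz').le)]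
      have h1 : p z * (θ - z) < p (M.c θ) * (θ - M.c θ) := by
        rcases le_or_gt θ z with hle | hlt
        · have := mul_nonpos_of_nonneg_of_nonpos (hpos z).le (by linarith : θ - z ≤ 0)
          have := mul_pos (hpos (M.c θ)) (by linarith : 0 < θ - M.c θ)
          linarith
        · calc p z * (θ - z) ≤ p (M.c θ) * (θ - z) :=
                mul_le_mul_of_nonneg_right (hanti hcs (hcs.trans hz') hz'.le) (by linarith)
            _ < p (M.c θ) * (θ - M.c θ) :=
                mul_lt_mul_of_pos_left (by linarith) (hpos _)
      linarith

/-- The indifference parameter: at `x = c(1)` the type `0` has a larger ratio than `θlow` by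
assumption, and at `x = θ*` the ratio of `g₂⁻¹(x) = θ*` is infinite. -/
lemma exists_indifferent {g₁ g₂ : ℝ → ℝ} {θbar θlow : ℝ} (hg : M.IsMatchingPair g₁ g₂ θbar θlow)
    (hbar : θbar < M.θs) {α : ℝ → ℝ} (hα_pos : ∀ θ ∈ Icc (0 : ℝ) 1, 0 < α θ)
    (hα : ContinuousOn α (Icc 0 M.θs)) (hlow : α 0 / M.c 1 > α θlow / (M.c 1 - θlow)) :
    ∃ x ∈ Ioo M.θs (M.c 1), α (inv g₁ 0 θbar x) / (x - inv g₁ 0 θbar x) =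
      α (inv g₂ θlow M.θs x) / (x - inv g₂ θlow M.θs x) := by
  obtain ⟨h₁, h₂⟩ := hg
  have hθ0 := M.θs_pos
  have hθ1 := M.θs_lt_one
  have hc1 := M.θs_lt_c_one
  have hA₁ := h₁.isPooling
  have hA₂ := h₂.isPooling
  set A₁ := fun t => inv g₁ 0 θbar (M.c t) with hA₁def
  set A₂ := fun t => inv g₂ θlow M.θs (M.c t) with hA₂def
  -- The difference of the two ratios, cleared of denominators to be continuous at `θ*`.
  set H : ℝ → ℝ := fun t => α (A₁ t) * (M.c t - A₂ t) - α (A₂ t) * (M.c t - A₁ t) with hH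
  have hcont : ContinuousOn H (Icc M.θs 1) :=
    ((hα.comp hA₁.continuousOn hA₁.mapsTo).mul (M.c_continuousOn_top.sub hA₂.continuousOn)).sub
      ((hα.comp hA₂.continuousOn hA₂.mapsTo).mul (M.c_continuousOn_top.sub hA₁.continuousOn))
  have hHθ : H M.θs < 0 := by
    simp only [hH, hA₁def, hA₂def, M.c_θs, h₁.inv_θs, h₂.inv_θs, sub_self, mul_zero, zero_sub]
    exact neg_neg_of_pos (mul_pos (hα_pos _ ⟨hθ0.le, hθ1.le⟩) (by linarith))
  have hH1 : 0 < H 1 := by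
    have h2 := h₂.lo_lt_hi
    rw [gt_iff_lt, div_lt_div_iff₀ (by linarith) (by linarith)] at hlow
    simp only [hH, hA₁def, hA₂def, h₁.inv_c_one, h₂.inv_c_one, sub_zero]
    linarith
  obtain ⟨t, ht, hHt⟩ := intermediate_value_Ioo hθ1.le hcont ⟨hHθ, hH1⟩
  have ht' : t ∈ Ioc M.θs 1 := ⟨ht.1, ht.2.le⟩
  have htc := M.θs_lt_c ht'
  refine ⟨M.c t, ⟨htc, M.c_strictMonoOn_top ⟨ht.1.le, ht.2.le⟩ ⟨hθ1.le, le_rfl⟩ ht.2⟩, ?_⟩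
  have e₁ := (hA₁.mapsTo ⟨ht.1.le, ht.2.le⟩).2
  have e₂ := (hA₂.mapsTo ⟨ht.1.le, ht.2.le⟩).2
  simp only [hA₁def, hA₂def] at e₁ e₂
  rw [div_eq_div_iff (by linarith) (by linarith)]
  simp only [hH, hA₁def, hA₂def] at hHt
  linarith

end Market

theorem proposition3 (M : Market) (hM : M.NoFullTrade)
    (α : ℝ → ℝ)
    (hα_meas : Measurable fun θ : Set.Icc (0 : ℝ) 1 => α θ)
    (hα_pos : ∀ θ ∈ Set.Icc (0 : ℝ) 1, 0 < α θ)
    (hα_bdd : ∃ K : ℝ, ∀ θ ∈ Set.Icc (0 : ℝ) 1, α θ ≤ K)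
    (hα_cont : ContinuousOn α (Set.Icc 0 M.θs))
    (hα_convex : ∀ x ∈ Set.Icc M.θs (M.c 1),
      StrictConvexOn ℝ (Set.Icc 0 M.θs \ {x}) (fun θ => α θ / (x - θ))) :
    -- the matching functions exist
    (∃ (g₁ g₂ : ℝ → ℝ) (θbar θlow : ℝ), M.IsMatchingPair g₁ g₂ θbar θlow) ∧
    ∀ (g₁ g₂ : ℝ → ℝ) (θbar θlow : ℝ), M.IsMatchingPair g₁ g₂ θbar θlow →
      -- the cutoffs are ordered as the construction of `π^{x-NAM}` requires
      (θbar ∈ Set.Ioo 0 M.θs ∧ θlow ∈ Set.Ioo 0 M.θs ∧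
        ∀ x ∈ Set.Ioo M.θs (M.c 1),
          0 < Market.inv g₁ 0 θbar x ∧
          Market.inv g₁ 0 θbar x < Market.inv g₂ θlow M.θs x ∧
          Market.inv g₂ θlow M.θs x < M.θs) ∧
      (α 0 / M.c 1 > α θlow / (M.c 1 - θlow) →
        (∃ x ∈ Set.Ioo M.θs (M.c 1), M.IsSolution α (M.nam g₁ g₂ θbar θlow x)) ∧
        ∀ (π : MeasureTheory.Measure (ℝ × ℝ)) [MeasureTheory.IsProbabilityMeasure π],
          M.IsSolution α π →
          ∃ x ∈ Set.Ioo M.θs (M.c 1),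
            ∀ᵐ θ ∂M.prior,
              π.condKernel θ = (M.nam g₁ g₂ θbar θlow x).condKernel θ) := by
  refine ⟨hM.exists_isMatchingPair, fun g₁ g₂ θbar θlow hg => ?_⟩
  obtain ⟨hbar, hlt⟩ := hM.cutoffs hg
  have hord : ∀ x ∈ Ioo M.θs (M.c 1), M.OrderedCutoffs g₁ g₂ θbar θlow x := fun x hx =>
    ⟨hg.first, hg.second, hx, hlt x ⟨hx.1.le, hx.2.le⟩⟩
  have hlow : 0 < θlow := by
    have := hlt (M.c 1) ⟨M.θs_lt_c_one.le, le_rfl⟩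
    rwa [hg.first.inv_c_one, hg.second.inv_c_one] at this
  refine ⟨⟨⟨hg.first.lo_lt_hi, hbar⟩, ⟨hlow, hg.second.lo_lt_hi⟩, fun x hx =>
    ⟨(hord x hx).first_pos, (hord x hx).lt, (hord x hx).second_lt⟩⟩, fun hineq => ?_⟩
  obtain ⟨x, hx, hxeq⟩ := Market.exists_indifferent hg hbar hα_pos hα_cont hineq
  have h := hord x hx
  have hP : 0 < α (Market.inv g₁ 0 θbar x) / (x - Market.inv g₁ 0 θbar x) := by
    have h1 := h.first_pos
    have h2 := h.lt
    have h3 := h.second_lt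
    have h4 := M.θs_lt_one
    exact div_pos (hα_pos _ ⟨h1.le, by linarith⟩) (by linarith [hx.1])
  have hconv : StrictConvexOn ℝ (Icc 0 M.θs) fun θ => α θ / (x - θ) := by
    have := hα_convex x ⟨hx.1.le, hx.2.le⟩
    rwa [sdiff_singleton_eq_self fun hmem => absurd hmem.2 (not_le.2 hx.1)] at this
  obtain ⟨K, hK⟩ := hα_bdd
  have hαm : AEMeasurable α M.prior := by
    rw [← M.prior_restrict_Icc]
    exact aemeasurable_restrict_of_measurable_subtype measurableSet_Icc hα_meas
  obtain ⟨hsol, huniq⟩ := (h.supports hP hconv rfl hxeq.symm).isSolution_and_unique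
    h.aemeasurable_namMap h.feasible_nam hαm
    fun θ hθ => (abs_of_pos (hα_pos θ hθ)).trans_le (hK θ hθ)
  refine ⟨⟨x, hx, hsol⟩, fun π _ hπ => ⟨x, hx, ?_⟩⟩
  -- The joint distributions coincide, so their kernels agree everywhere.
  obtain rfl : π = M.nam g₁ g₂ θbar θlow x := huniq π hπ
  exact Filter.Eventually.of_forall fun _ => rfl
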